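/- **Setting.** Let $X\ge 0$ be a random variable with distribution $F_X$ such that $\mathbb E[\log(1+X)]<\infty$, let $\theta>0$ and $c>0$. For $\lambda\ge 0$ put $\psi_{F_X}(\lambda)=\mathbb E[\log(1+\lambda X)]$. For a distribution $F$ on $[0,\infty)$, let $P$ be a Dirichlet process with total mass $\theta$ and prior $F$, i.e. a random probability measure on $[0,\infty)$ such that for every finite measurable partition $(C_1,\dots,C_k)$ of $[0,\infty)$ the vector $(P(C_1),\dots,P(C_k))$ has the Dirichlet distribution with parameters $(\theta F(C_1),\dots,\theta F(C_k))$. Let $M_\theta(F)=\int_0^\infty x\,P(\mathrm dx)$ be its mean. Let $G_\theta$ be a gamma$(\theta,1)$ variable independent of $M_\theta(F)$; GGC$(\theta,F)$ is the distribution of $G_\theta M_\theta(F)$. Let $A_c=cX/(cX+1)$, with distribution $F_{A_c}$. **Theorem.** $M_\theta(F_X)$ is almost surely finite, and the following hold. *Tilting.* Suppose $T_\theta=G_\theta M_\theta(F_X)$ has density $g$. Then the exponentially tilted density $$\frac{e^{-t}\,\frac1c\,g(t/c)}{\mathbb E[e^{-cT_\theta}]}=e^{-t}\,\tfrac1c\,g(t/c)\,e^{\theta\psi_{F_X}(c)}$$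 is the density of a random variable $\tilde T_{\theta,c}$ with Laplace transform $$\mathbb E[e^{-\lambda \tilde T_{\theta,c}}]=e^{-\theta[\psi_{F_X}(c(1+\lambda))-\psi_{F_X}(c)]}\qquad(\lambda\ge 0),$$ and $\tilde T_{\theta,c}$ is a GGC$(\theta,F_{A_c})$ random variable, that is, it has the distribution of $G_\theta M_\theta(F_{A_c})$. *(i)* If $M_\theta(F_X)$ has density $\xi_{\theta F_X}$, then $M_\theta(F_{A_c})$ has the density $$\xi_{\theta F_{A_c}}(y)=\frac1c\,e^{\theta\psi_{F_X}(c)}(1-y)^{\theta-2}\,\xi_{\theta F_X}\!\left(\frac{y}{c(1-y)}\right)\quad\text{for }0<y<1,$$ and $0$ for all other $y$. *(ii)* Conversely, if $M_\theta(F_{A_1})$ has density $\xi_{\theta F_{A_1}}$, then $M_\theta(F_X)$ has the density $$\xi_{\theta F_X}(x)=(1+x)^{\theta-2}\,\xi_{\theta F_{A_1}}\!\left(\frac{x}{1+x}\right)e^{-\theta\psi_{F_X}(1)}\quad\text{for }x>0,$$ and $0$ for all other $x$. -/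

import Mathlib

open MeasureTheory ProbabilityTheory
open scoped NNReal ENNReal

noncomputable section

/-- The gamma distribution with shape `a` and rate `1`; for `a = 0` it is the unit mass at `0`
(the convention needed for cells of zero mass in a Dirichlet distribution). -/
def gammaLaw (a : ℝ) : Measure ℝ :=
  if 0 < a then gammaMeasure a 1 else Measure.dirac 0

/-- The `k`-variate Dirichlet distribution with parameters `a i ≥ 0` (not all zero): the law of
`(G i / ∑ j, G j)` for independent gamma variables `G i` with shapes `a i` and rate `1`. -/
def dirichletLaw {k : ℕ} (a : Fin k → ℝ) : Measure (Fin k → ℝ) :=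
  (Measure.pi fun i => gammaLaw (a i)).map fun g i => g i / ∑ j, g j

/-- `Q` is the law (on the space of measures on `[0, ∞)`) of a Dirichlet process with total mass
`θ` and prior `F`: a random probability measure `P` such that, for every finite measurable
partition `C 0, …, C (k-1)` of `[0, ∞)`, the vector `(P (C i))` is Dirichlet distributed with
parameters `θ * F (C i)`. A random measure `P` on a probability space `(Ω, ℙ)` is a Dirichlet
process exactly when its law `ℙ.map P` has this property. -/
structure IsDirichletProcessLaw (θ : ℝ) (F : Measure ℝ≥0) (Q : Measure (Measure ℝ≥0)) :
    Prop where
  isProbabilityMeasure : IsProbabilityMeasure Q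
  ae_isProbabilityMeasure : ∀ᵐ P ∂Q, IsProbabilityMeasure P
  map_partition : ∀ (k : ℕ) (C : Fin k → Set ℝ≥0), (∀ i, MeasurableSet (C i)) →
    Pairwise (fun i j => Disjoint (C i) (C j)) → (⋃ i, C i) = Set.univ →
    Q.map (fun P i => P.real (C i)) = dirichletLaw fun i => θ * F.real (C i)

/-- The (possibly infinite) mean of a measure on `[0, ∞)`. -/
def meanFunctional (P : Measure ℝ≥0) : ℝ≥0∞ := ∫⁻ x, (x : ℝ≥0∞) ∂P

/-- `ν` is the law of the Dirichlet mean `M_θ(F) = ∫ x P(dx)`, with `P` a Dirichlet process with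
parameters `(θ, F)`. To be used when this integral is almost surely finite. -/
def IsDirichletMeanLaw (θ : ℝ) (F : Measure ℝ≥0) (ν : Measure ℝ) : Prop :=
  ∃ Q, IsDirichletProcessLaw θ F Q ∧ ν = Q.map fun P => (meanFunctional P).toReal

/-- The law of `G * M` where `G` is gamma with shape `θ` and rate `1`, `M` has law `ν`, and `G`
and `M` are independent. -/
def gammaMixture (θ : ℝ) (ν : Measure ℝ) : Measure ℝ :=
  ((gammaMeasure θ 1).prod ν).map fun z => z.1 * z.2

/-- `τ` is the generalized gamma convolution distribution `GGC(θ, F)`, that is, the law of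
`G_θ * M_θ(F)` with independent factors. -/
def IsGGC (θ : ℝ) (F : Measure ℝ≥0) (τ : Measure ℝ) : Prop :=
  ∃ ν, IsDirichletMeanLaw θ F ν ∧ τ = gammaMixture θ ν

/-- The Lévy exponent `ψ_F(l) = ∫ log (1 + l x) F(dx)`. -/
def levyExponent (F : Measure ℝ≥0) (l : ℝ) : ℝ := ∫ x, Real.log (1 + l * (x : ℝ)) ∂F

/-- `f` is a probability density, with respect to Lebesgue measure, of the law `ν`. -/
structure IsDensity (ν : Measure ℝ) (f : ℝ → ℝ) : Prop where
  measurable : Measurable f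
  nonneg : ∀ x, 0 ≤ f x
  eq_withDensity : ν = volume.withDensity fun x => ENNReal.ofReal (f x)

/-- Exponential tilting: if `T` has density `g`, this is the density
`e^{-t} (1/c) g(t/c) / E[e^{-cT}]` of the tilted variable. -/
def tiltedDensity (c : ℝ) (g : ℝ → ℝ) (t : ℝ) : ℝ :=
  Real.exp (-t) * (1 / c * g (t / c)) / ∫ s, Real.exp (-c * s) * g s

/-- The law of `A_c = c X / (c X + 1)`, where `X` has law `F`. -/
def lawA (c : ℝ≥0) (F : Measure ℝ≥0) : Measure ℝ≥0 := F.map fun x => c * x / (c * x + 1)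

end

/-! Everything rests on the Cifarelli–Regazzini identity `E[(1 + l M)^(-θ)] = exp(-θ ψ_F(l))` for
the mean `M` of a Dirichlet process with prior `F`. For Dirichlet vectors it comes from normalizing
independent gamma variables (`lintegral_dirichletLaw`); simple functions reduce to that case, and
monotone approximation gives the general one (`lintegral_dirichletProcess`). Read in `ℝ≥0∞`, where
an infinite mean contributes `0` for `l > 0`, it forces `M` to be almost surely finite as `l → 0`.

Since `1 + l·cx/(cx+1) = (1 + c(1+l)x)/(1 + cx)`, the exponent of `A_c` is `ψ_F(c(1+l)) - ψ_F(c)`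
(`levyExponent_lawA`). As `exp(-θ ψ)` is the Laplace transform of the GGC law, tilting by `e^{-cT}`
and scaling by `c` lands in `GGC(θ, F_{A_c})`. For the means, the same algebra says that weighting
by `exp(θ ψ_F(c)) (1 + cm)^(-θ)` and mapping `m ↦ cm/(cm+1)` gives the law of `M_θ(F_{A_c})`
(`IsDirichletMeanLaw.lawA_eq`).

Uniqueness at the level of means: an independent gamma factor turns the Stieltjes transform into a
Laplace transform, which determines the mixture (`ext_of_laplace`); the gamma factor is then
cancelled through moments, one mixing law being carried by `[0, 1]` (`eq_of_gammaMixture_eq`). The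
density formulas are changes of variables, the converse one after inverting weight and map. -/

/-! ### Gamma laws: change of rate and scaling. -/

theorem measurable_gammaPDF (a r : ℝ) : Measurable (gammaPDF a r) :=
  (measurable_gammaPDFReal a r).ennreal_ofReal

/-- A gamma measure of rate `r` is an exponential tilt of the one of rate `1`. -/
theorem gammaMeasure_eq_withDensity {a r : ℝ} (hr : 0 < r) :
    gammaMeasure a r = (gammaMeasure a 1).withDensity
      fun x => ENNReal.ofReal (r ^ a * Real.exp (-((r - 1) * x))) := by
  rw [gammaMeasure, gammaMeasure, ← withDensity_mul _ (measurable_gammaPDF a 1)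
    (by fun_prop)]
  congr 1
  ext x
  simp only [Pi.mul_apply]
  rcases lt_or_ge x 0 with hx | hx
  · simp [gammaPDF_of_neg hx]
  · rw [gammaPDF_of_nonneg hx, gammaPDF_of_nonneg hx, ← ENNReal.ofReal_mul' (by positivity)]
    have : Real.exp (-(r * x)) = Real.exp (-(1 * x)) * Real.exp (-((r - 1) * x)) := by
      rw [← Real.exp_add]; ring_nf
    rw [this, Real.one_rpow]
    ring_nf

theorem lintegral_comp_inv_mul {r : ℝ} (hr : 0 < r) {f : ℝ → ℝ≥0∞} (hf : Measurable f) :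
    ∫⁻ x, f (r⁻¹ * x) = ENNReal.ofReal r * ∫⁻ x, f x := by
  have h := Real.smul_map_volume_mul_left (inv_pos.2 hr).ne'
  conv_rhs => rw [← h]
  rw [lintegral_smul_measure, lintegral_map hf (by fun_prop), abs_of_pos (inv_pos.2 hr),
    smul_eq_mul, ← mul_assoc, ← ENNReal.ofReal_mul hr.le, mul_inv_cancel₀ hr.ne']
  simp

theorem gammaMeasure_map_inv_mul {a r : ℝ} (hr : 0 < r) :
    (gammaMeasure a 1).map (fun x => r⁻¹ * x) = gammaMeasure a r := by
  refine Measure.ext_of_lintegral _ fun f hf => ?_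
  rw [lintegral_map hf (by fun_prop), gammaMeasure, gammaMeasure,
    lintegral_withDensity_eq_lintegral_mul _ (measurable_gammaPDF a 1)
      (by fun_prop),
    lintegral_withDensity_eq_lintegral_mul _ (measurable_gammaPDF a r) hf]
  have hm : Measurable (fun y => ENNReal.ofReal (r⁻¹) * (gammaPDF a r y * f y)) :=
    ((measurable_gammaPDF a r).mul hf).const_mul _
  have key := lintegral_comp_inv_mul hr hm
  rw [lintegral_const_mul (f := fun x => gammaPDF a r x * f x) _
    ((measurable_gammaPDF a r).mul hf), ← mul_assoc, ← ENNReal.ofReal_mul hr.le, mul_inv_cancel₀ hr.ne', ENNReal.ofReal_one, one_mul] at key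
  simp only [Pi.mul_apply]
  rw [← key]
  refine lintegral_congr_ae ?_
  filter_upwards [compl_mem_ae_iff.2 (measure_singleton (0 : ℝ))] with x hx0
  rw [← mul_assoc]
  congr 1
  rcases lt_or_gt_of_ne hx0 with hx | hx
  · rw [gammaPDF_of_neg hx, gammaPDF_of_neg (mul_neg_of_pos_of_neg (inv_pos.2 hr) hx), mul_zero]
  · have hx' : 0 < r⁻¹ * x := mul_pos (inv_pos.2 hr) hx
    rw [gammaPDF_of_nonneg hx.le, gammaPDF_of_nonneg hx'.le,
      ← ENNReal.ofReal_mul (inv_pos.2 hr).le]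
    congr 1
    rw [Real.mul_rpow (inv_pos.2 hr).le hx.le, Real.inv_rpow hr.le, Real.rpow_sub_one hr.ne',
      Real.one_rpow, ← mul_assoc r, mul_inv_cancel₀ hr.ne']
    have := (Real.rpow_pos_of_pos hr a).ne'
    field_simp

theorem isProbabilityMeasure_gammaLaw (a : ℝ) : IsProbabilityMeasure (gammaLaw a) := by
  unfold gammaLaw
  split_ifs with h
  · exact isProbabilityMeasure_gammaMeasure h one_pos
  · infer_instance

attribute [instance] isProbabilityMeasure_gammaLaw

theorem gammaLaw_map_inv_mul {a r : ℝ} (ha : 0 ≤ a) (hr : 0 < r) :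
    (gammaLaw a).map (fun x => r⁻¹ * x) = (gammaLaw a).withDensity
      fun x => ENNReal.ofReal (r ^ a * Real.exp (-((r - 1) * x))) := by
  unfold gammaLaw
  split_ifs with h
  · rw [gammaMeasure_map_inv_mul hr, gammaMeasure_eq_withDensity hr]
  · obtain rfl : a = 0 := le_antisymm (not_lt.1 h) ha
    rw [Measure.map_dirac' (by fun_prop), dirac_withDensity]
    simp

theorem ae_pos_gammaMeasure (a r : ℝ) : ∀ᵐ x ∂gammaMeasure a r, 0 < x := by
  rw [gammaMeasure, ae_withDensity_iff (measurable_gammaPDF a r)]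
  filter_upwards [compl_mem_ae_iff.2 (measure_singleton (0 : ℝ))] with x hx0 hx
  by_contra h
  exact hx (gammaPDF_of_neg (lt_of_le_of_ne (not_lt.1 h) hx0))

theorem ae_nonneg_gammaLaw (a : ℝ) : ∀ᵐ x ∂gammaLaw a, 0 ≤ x := by
  unfold gammaLaw
  split_ifs with h
  · exact (ae_pos_gammaMeasure a 1).mono fun x hx => hx.le
  · simp [ae_dirac_eq]

/-! ### Product measures and vectors of independent gamma variables. -/

theorem lintegral_pi_prod {ι : Type*} [Fintype ι] {α : ι → Type*} [∀ i, MeasurableSpace (α i)]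
    (μ : ∀ i, Measure (α i)) [∀ i, IsProbabilityMeasure (μ i)] {f : ∀ i, α i → ℝ≥0∞}
    (hf : ∀ i, Measurable (f i)) :
    ∫⁻ x, ∏ i, f i (x i) ∂Measure.pi μ = ∏ i, ∫⁻ x, f i x ∂μ i := by
  have hind : iIndepFun (fun i (x : ∀ i, α i) => f i (x i)) (Measure.pi μ) :=
    iIndepFun_pi (X := f) fun i => (hf i).aemeasurable
  rw [lintegral_prod_eq_prod_lintegral_of_indepFun Finset.univ _ hind
    fun i => (hf i).comp (measurable_pi_apply i)]
  refine Finset.prod_congr rfl fun i _ => ?_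
  rw [← lintegral_map (hf i) (measurable_pi_apply i), (measurePreserving_eval μ i).map_eq]

/-- It suffices to test boxes, whose indicator factors over the coordinates. -/
theorem pi_withDensity {ι : Type*} [Fintype ι] {α : ι → Type*} [∀ i, MeasurableSpace (α i)]
    (μ : ∀ i, Measure (α i)) [∀ i, IsProbabilityMeasure (μ i)] {f : ∀ i, α i → ℝ≥0∞}
    (hf : ∀ i, Measurable (f i)) [∀ i, SigmaFinite ((μ i).withDensity (f i))] :
    Measure.pi (fun i => (μ i).withDensity (f i))
      = (Measure.pi μ).withDensity fun x => ∏ i, f i (x i) := by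
  refine Measure.pi_eq fun s hs => ?_
  rw [withDensity_apply _ (MeasurableSet.univ_pi hs), ← lintegral_indicator
    (MeasurableSet.univ_pi hs)]
  have : ∀ x : ∀ i, α i, (Set.univ.pi s).indicator (fun x => ∏ i, f i (x i)) x
      = ∏ i, (s i).indicator (f i) (x i) := by
    intro x
    by_cases hx : x ∈ Set.univ.pi s
    · rw [Set.indicator_of_mem hx]
      exact Finset.prod_congr rfl fun i _ => (Set.indicator_of_mem (hx i trivial) _).symm
    · rw [Set.indicator_of_notMem hx]
      simp only [Set.mem_pi, Set.mem_univ, true_imp_iff, not_forall] at hx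
      obtain ⟨i, hi⟩ := hx
      exact (Finset.prod_eq_zero (Finset.mem_univ i) (Set.indicator_of_notMem hi _)).symm
  simp_rw [this]
  rw [lintegral_pi_prod μ fun i => (hf i).indicator (hs i)]
  refine Finset.prod_congr rfl fun i _ => ?_
  rw [lintegral_indicator (hs i), withDensity_apply _ (hs i)]

/-- Changing the rates of independent gamma variables amounts to an exponential tilt. -/
theorem lintegral_pi_gammaLaw_comp_inv_mul {ι : Type*} [Fintype ι] {a r : ι → ℝ}
    (ha : ∀ i, 0 ≤ a i) (hr : ∀ i, 0 < r i) {Φ : (ι → ℝ) → ℝ≥0∞} (hΦ : Measurable Φ) :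
    ∫⁻ g, Φ (fun i => (r i)⁻¹ * g i) ∂Measure.pi (fun i => gammaLaw (a i))
      = ∫⁻ g, ENNReal.ofReal ((∏ i, r i ^ a i) * Real.exp (-∑ i, (r i - 1) * g i)) * Φ g
          ∂Measure.pi (fun i => gammaLaw (a i)) := by
  have hprob : ∀ i, IsProbabilityMeasure ((gammaLaw (a i)).map (fun x => (r i)⁻¹ * x)) :=
    fun i => Measure.isProbabilityMeasure_map (by fun_prop)
  have hprob' : ∀ i, IsProbabilityMeasure ((gammaLaw (a i)).withDensity
      fun x => ENNReal.ofReal (r i ^ a i * Real.exp (-((r i - 1) * x)))) := fun i => by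
    rw [← gammaLaw_map_inv_mul (ha i) (hr i)]; exact hprob i
  have h := Measure.pi_map_pi (μ := fun i => gammaLaw (a i)) (f := fun i x => (r i)⁻¹ * x)
    (fun i => by fun_prop)
  simp_rw [gammaLaw_map_inv_mul (ha _) (hr _)] at h
  rw [pi_withDensity _ (fun i => by fun_prop)] at h
  rw [← lintegral_map (f := Φ) hΦ (by fun_prop), h,
    lintegral_withDensity_eq_lintegral_mul _ (by fun_prop) hΦ]
  refine lintegral_congr fun g => ?_
  simp only [Pi.mul_apply]
  rw [← ENNReal.ofReal_prod_of_nonneg fun i _ =>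
    mul_nonneg (Real.rpow_nonneg (hr i).le _) (Real.exp_pos _).le, Finset.prod_mul_distrib,
    ← Real.exp_sum, Finset.sum_neg_distrib]

/-- Changing the rates to `1 + x i` with test function `1` shows that this integral times `∏ (1 + x
i) ^ a i` is a total mass, hence `1`. -/
theorem lintegral_pi_gammaLaw_exp_neg {ι : Type*} [Fintype ι] {a x : ι → ℝ}
    (ha : ∀ i, 0 ≤ a i) (hx : ∀ i, 0 ≤ x i) :
    ∫⁻ g, ENNReal.ofReal (Real.exp (-∑ i, x i * g i)) ∂Measure.pi (fun i => gammaLaw (a i))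
      = ENNReal.ofReal (∏ i, (1 + x i) ^ (-a i)) := by
  have hp : ∀ i, 0 < 1 + x i := fun i => by linarith [hx i]
  have hpos : 0 < ∏ i, (1 + x i) ^ a i := Finset.prod_pos fun i _ => Real.rpow_pos_of_pos (hp i) _
  have h := lintegral_pi_gammaLaw_comp_inv_mul ha hp (Φ := 1) measurable_one
  simp only [Pi.one_apply, lintegral_one, measure_univ, mul_one, add_sub_cancel_left] at h
  simp_rw [ENNReal.ofReal_mul hpos.le] at h
  rw [lintegral_const_mul _ (by fun_prop)] at h
  have h2 : ENNReal.ofReal (∏ i, (1 + x i) ^ (-a i)) * ENNReal.ofReal (∏ i, (1 + x i) ^ a i) = 1 := by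
    rw [← ENNReal.ofReal_mul' hpos.le, ← Finset.prod_mul_distrib, Finset.prod_eq_one]
    · simp
    · intro i _
      rw [← Real.rpow_add (hp i)]; simp
  calc _ = ENNReal.ofReal (∏ i, (1 + x i) ^ (-a i)) * (ENNReal.ofReal (∏ i, (1 + x i) ^ a i) *
        ∫⁻ g, ENNReal.ofReal (Real.exp (-∑ i, x i * g i))
          ∂Measure.pi (fun i => gammaLaw (a i))) := by rw [← mul_assoc, h2, one_mul]
    _ = _ := by rw [← h, mul_one]

/-! ### Stieltjes transform of a Dirichlet vector. -/

theorem lintegral_rpow_mul_exp_neg_mul {θ z : ℝ} (hθ : 0 < θ) (hz : 0 < z) :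
    ∫⁻ v in Set.Ioi (0 : ℝ), ENNReal.ofReal (v ^ (θ - 1) * Real.exp (-(z * v)))
      = ENNReal.ofReal (Real.Gamma θ * z ^ (-θ)) := by
  have hi : IntegrableOn (fun v : ℝ => v ^ (θ - 1) * Real.exp (-(z * v))) (Set.Ioi 0) := by
    -- Without integrability the Bochner integral would be `0`, but its closed form is positive.
    by_contra hni
    have h := Real.integral_rpow_mul_exp_neg_mul_Ioi hθ hz
    rw [integral_undef hni] at h
    have : 0 < (1 / z) ^ θ * Real.Gamma θ := by
      have := Real.Gamma_pos_of_pos hθ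
      positivity
    exact this.ne h
  rw [← ofReal_integral_eq_lintegral_ofReal hi, Real.integral_rpow_mul_exp_neg_mul_Ioi hθ hz,
    one_div, Real.inv_rpow hz.le, Real.rpow_neg hz.le, mul_comm]
  filter_upwards [ae_restrict_mem measurableSet_Ioi] with v (hv : 0 < v)
  exact mul_nonneg (Real.rpow_nonneg hv.le _) (Real.exp_pos _).le

/-- Substitute `v ↦ v⁻¹` in the gamma integral. -/
theorem lintegral_rpow_mul_exp_neg_div {θ z : ℝ} (hθ : 0 < θ) (hz : 0 < z) :
    ∫⁻ v in Set.Ioi (0 : ℝ), ENNReal.ofReal (v ^ (-θ - 1) * Real.exp (-(z * v⁻¹)))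
      = ENNReal.ofReal (Real.Gamma θ * z ^ (-θ)) := by
  rw [← lintegral_rpow_mul_exp_neg_mul hθ hz]
  have himg : (fun v : ℝ => v⁻¹) '' Set.Ioi 0 = Set.Ioi 0 := by
    ext v
    constructor
    · rintro ⟨w, hw, rfl⟩
      exact Set.mem_Ioi.2 (inv_pos.2 (Set.mem_Ioi.1 hw))
    · exact fun hv => ⟨v⁻¹, Set.mem_Ioi.2 (inv_pos.2 (Set.mem_Ioi.1 hv)), inv_inv v⟩
  conv_rhs => rw [← himg]
  rw [lintegral_image_eq_lintegral_abs_deriv_mul (f' := fun v => -(v ^ 2)⁻¹) measurableSet_Ioi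
    (fun v hv => (hasDerivAt_inv (ne_of_gt hv)).hasDerivWithinAt) inv_injective.injOn]
  refine setLIntegral_congr_fun measurableSet_Ioi fun v (hv : 0 < v) => ?_
  rw [← ENNReal.ofReal_mul (abs_nonneg _), abs_neg, abs_of_pos (by positivity), ← mul_assoc,
    Real.inv_rpow hv.le, ← Real.rpow_neg hv.le, ← Real.rpow_natCast, ← Real.rpow_neg hv.le,
    ← Real.rpow_add hv]
  rw [show -θ - 1 = -((2 : ℕ) : ℝ) + -(θ - 1) by push_cast; ring]

theorem ae_sum_pos_pi_gammaLaw {ι : Type*} [Fintype ι] {a : ι → ℝ} (hs : 0 < ∑ i, a i) :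
    ∀ᵐ g ∂Measure.pi (fun i => gammaLaw (a i)), (∀ i, 0 ≤ g i) ∧ 0 < ∑ i, g i := by
  have hev : ∀ (p : ℝ → Prop) (i : ι), (∀ᵐ x ∂gammaLaw (a i), p x) →
      ∀ᵐ g ∂Measure.pi (fun i => gammaLaw (a i)), p (g i) := fun p i h =>
    (measurePreserving_eval (fun i => gammaLaw (a i)) i).quasiMeasurePreserving.ae h
  obtain ⟨i, -, hi⟩ := Finset.exists_lt_of_sum_lt (s := Finset.univ) (f := fun _ : ι => (0 : ℝ))
    (g := a) (by simpa using hs)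
  have h1 : ∀ᵐ x ∂gammaLaw (a i), 0 < x := by
    rw [gammaLaw, if_pos hi]
    exact ae_pos_gammaMeasure _ _
  filter_upwards [ae_all_iff.2 fun j => hev (0 ≤ ·) j (ae_nonneg_gammaLaw (a j)),
    hev (0 < ·) i h1] with g hg hgi
  exact ⟨hg, Finset.sum_pos' (fun j _ => hg j) ⟨i, Finset.mem_univ i, hgi⟩⟩

/-- Normalizing independent gamma variables: the key instance of the independence of the sum and
the normalized vector. -/
theorem lintegral_pi_gammaLaw_ratio {ι : Type*} [Fintype ι] {a x : ι → ℝ}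
    (ha : ∀ i, 0 ≤ a i) (hx : ∀ i, 0 ≤ x i) (hs : 0 < ∑ i, a i) :
    ∫⁻ g, ENNReal.ofReal ((∑ i, g i) ^ (∑ i, a i) *
        (∑ i, g i + ∑ i, x i * g i) ^ (-∑ i, a i)) ∂Measure.pi (fun i => gammaLaw (a i))
      = ENNReal.ofReal (∏ i, (1 + x i) ^ (-a i)) := by
  set θ := ∑ i, a i with hθ
  set m := Measure.pi (fun i => gammaLaw (a i)) with hm
  have hΓ : 0 < Real.Gamma θ := Real.Gamma_pos_of_pos hs
  have hΓ' : ENNReal.ofReal (Real.Gamma θ) ≠ 0 := by simpa using hΓ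
  have hae := ae_sum_pos_pi_gammaLaw hs
  refine (ENNReal.mul_right_inj hΓ' ENNReal.ofReal_ne_top).1 ?_
  rw [← lintegral_pi_gammaLaw_exp_neg ha hx, ← lintegral_const_mul _ (by fun_prop),
    ← lintegral_const_mul _ (by fun_prop)]
  -- With `S = ∑ g i` and `L = ∑ x i * g i`, both sides become integrals over an auxiliary `v > 0`:
  -- here `(S + L)^(-θ)` is a gamma integral, and in `h2` the constant `Γ(θ)` is `S^θ ∫ v^(-θ-1)
  -- e^(-S/v) dv`.
  have h1 : ∀ᵐ g ∂m, ENNReal.ofReal (Real.Gamma θ) * ENNReal.ofReal ((∑ i, g i) ^ θ *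
      (∑ i, g i + ∑ i, x i * g i) ^ (-θ)) = ∫⁻ v in Set.Ioi (0 : ℝ), ENNReal.ofReal
        ((∑ i, g i) ^ θ * (v ^ (θ - 1) * Real.exp (-((∑ i, g i + ∑ i, x i * g i) * v)))) := by
    filter_upwards [hae] with g hg
    have hL : 0 ≤ ∑ i, x i * g i := Finset.sum_nonneg fun i _ => mul_nonneg (hx i) (hg.1 i)
    have hS : 0 ≤ (∑ i, g i) ^ θ := Real.rpow_nonneg hg.2.le _
    simp_rw [ENNReal.ofReal_mul hS]
    rw [lintegral_const_mul _ (by fun_prop),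
      lintegral_rpow_mul_exp_neg_mul hs (add_pos_of_pos_of_nonneg hg.2 hL),
      ENNReal.ofReal_mul hΓ.le]
    ring
  have h2 : ∀ᵐ g ∂m, ENNReal.ofReal (Real.Gamma θ) *
      ENNReal.ofReal (Real.exp (-∑ i, x i * g i)) = ∫⁻ v in Set.Ioi (0 : ℝ), ENNReal.ofReal
        ((∑ i, g i) ^ θ * Real.exp (-∑ i, x i * g i) *
          (v ^ (-θ - 1) * Real.exp (-((∑ i, g i) * v⁻¹)))) := by
    filter_upwards [hae] with g hg
    have hS : 0 < (∑ i, g i) ^ θ := Real.rpow_pos_of_pos hg.2 _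
    simp_rw [ENNReal.ofReal_mul (mul_nonneg hS.le (Real.exp_pos (-∑ i, x i * g i)).le)]
    rw [lintegral_const_mul _ (by fun_prop), lintegral_rpow_mul_exp_neg_div hs hg.2,
      ← ENNReal.ofReal_mul hΓ.le, ← ENNReal.ofReal_mul (by positivity), Real.rpow_neg hg.2.le]
    congr 1
    field_simp
  rw [lintegral_congr_ae h1, lintegral_congr_ae h2]
  refine (lintegral_lintegral_swap (by fun_prop)).trans
    (Eq.trans ?_ (lintegral_lintegral_swap (by fun_prop)).symm)
  refine setLIntegral_congr_fun measurableSet_Ioi fun v (hv : 0 < v) => ?_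
  -- For fixed `v`, the scaling `g ↦ v g` carries one integrand to the other. The factor `v ^ (-θ)`
  -- in `Φ` offsets `(v S)^θ`.
  have h3 := lintegral_pi_gammaLaw_comp_inv_mul (r := fun _ => v⁻¹) ha (fun _ => inv_pos.2 hv)
    (Φ := fun g => ENNReal.ofReal (v ^ (θ - 1) * v ^ (-θ) * (∑ i, g i) ^ θ *
      Real.exp (-(∑ i, g i + ∑ i, x i * g i)))) (by fun_prop)
  rw [← hm] at h3
  refine (Eq.trans ?_ h3).trans ?_
  · refine lintegral_congr_ae ?_
    filter_upwards [hae] with g hg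
    simp only [inv_inv]
    congr 1
    rw [← Finset.mul_sum, Real.mul_rpow hv.le hg.2.le]
    have e1 : ∑ i, x i * (v * g i) = v * ∑ i, x i * g i := by
      rw [Finset.mul_sum]; exact Finset.sum_congr rfl fun i _ => by ring
    have e2 : v ^ (-θ) * v ^ θ = 1 := by rw [← Real.rpow_add hv]; simp
    rw [e1, ← mul_add, mul_comm v (_ + _)]
    calc _ = (∑ i, g i) ^ θ * (v ^ (θ - 1) *
          Real.exp (-((∑ i, g i + ∑ i, x i * g i) * v))) * (v ^ (-θ) * v ^ θ) := by
            rw [e2, mul_one]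
      _ = _ := by ring
  · refine lintegral_congr_ae ?_
    filter_upwards [hae] with g hg
    rw [← Real.rpow_sum_of_pos (inv_pos.2 hv), ← hθ, ← ENNReal.ofReal_mul (by positivity)]
    congr 1
    have e1 : ∑ i, (v⁻¹ - 1) * g i = (∑ i, g i) * v⁻¹ - ∑ i, g i := by
      rw [← Finset.mul_sum]; ring
    have e2 : Real.exp (-∑ i, (v⁻¹ - 1) * g i) * Real.exp (-(∑ i, g i + ∑ i, x i * g i))
        = Real.exp (-∑ i, x i * g i) * Real.exp (-((∑ i, g i) * v⁻¹)) := by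
      rw [← Real.exp_add, ← Real.exp_add, e1]; ring_nf
    have e3 : v⁻¹ ^ θ * (v ^ (θ - 1) * v ^ (-θ)) = v ^ (-θ - 1) := by
      rw [Real.inv_rpow hv.le, ← Real.rpow_neg hv.le, ← Real.rpow_add hv, ← Real.rpow_add hv]
      ring_nf
    rw [← e3]
    linear_combination (v⁻¹ ^ θ * (v ^ (θ - 1) * v ^ (-θ)) * (∑ i, g i) ^ θ) * e2

/-- The generalized Stieltjes transform of a linear functional of a Dirichlet vector. -/
theorem lintegral_dirichletLaw {k : ℕ} {a x : Fin k → ℝ}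
    (ha : ∀ i, 0 ≤ a i) (hx : ∀ i, 0 ≤ x i) (hs : 0 < ∑ i, a i) :
    ∫⁻ d, ENNReal.ofReal ((1 + ∑ i, x i * d i) ^ (-∑ i, a i)) ∂dirichletLaw a
      = ENNReal.ofReal (∏ i, (1 + x i) ^ (-a i)) := by
  rw [dirichletLaw, lintegral_map (by fun_prop) (by fun_prop),
    ← lintegral_pi_gammaLaw_ratio ha hx hs]
  refine lintegral_congr_ae ?_
  filter_upwards [ae_sum_pos_pi_gammaLaw hs] with g hg
  have hL : 0 ≤ ∑ i, x i * g i := Finset.sum_nonneg fun i _ => mul_nonneg (hx i) (hg.1 i)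
  have hS := hg.2
  congr 1
  have e1 : 1 + ∑ i, x i * (g i / ∑ j, g j)
      = (∑ i, g i)⁻¹ * (∑ i, g i + ∑ i, x i * g i) := by
    simp_rw [← mul_div_assoc]
    rw [← Finset.sum_div]
    field_simp
  rw [e1, Real.mul_rpow (by positivity) (by positivity), Real.inv_rpow hS.le, ← Real.rpow_neg hS.le,
    neg_neg]

/-! ### From Dirichlet vectors to linear functionals of a Dirichlet process. -/

/-- The level sets of `f` form a finite partition, so `∫ f dP` is a linear functional of the
Dirichlet vector of their masses. -/
theorem lintegral_simpleFunc_dirichletProcess {θ : ℝ} (hθ : 0 < θ) {F : Measure ℝ≥0}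
    [IsProbabilityMeasure F] {Q : Measure (Measure ℝ≥0)} (hQ : IsDirichletProcessLaw θ F Q)
    (f : SimpleFunc ℝ≥0 ℝ≥0) :
    ∫⁻ P, (1 + ∫⁻ x, f x ∂P) ^ (-θ) ∂Q
      = ENNReal.ofReal (Real.exp (-θ * ∫ x, Real.log (1 + (f x : ℝ)) ∂F)) := by
  let e := f.range.equivFin.symm
  let y : Fin f.range.card → ℝ≥0 := fun i => (e i : ℝ≥0)
  let C : Fin f.range.card → Set ℝ≥0 := fun i => f ⁻¹' {y i}
  have hy : Function.Injective y := Subtype.val_injective.comp e.injective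
  have hCm : ∀ i, MeasurableSet (C i) := fun i => f.measurableSet_fiber _
  have hCd : Pairwise (fun i j => Disjoint (C i) (C j)) := fun i j hij =>
    Disjoint.preimage _ (by simpa using fun h => hij (hy h))
  have hmem : ∀ x, ∃ i, f x = y i := fun x =>
    ⟨f.range.equivFin ⟨f x, f.mem_range_self x⟩, by simp [y, e]⟩
  have hCu : (⋃ i, C i) = Set.univ := by
    ext x
    simpa [C] using hmem x
  have hsum : ∑ i, F.real (C i) = 1 := by
    rw [← measureReal_iUnion_fintype hCd hCm, hCu, probReal_univ]
  have hmap := hQ.map_partition _ C hCm hCd hCu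
  have hind : ∀ (h : ℝ≥0 → ℝ) x,
      h (f x) = ∑ i, (C i).indicator (fun _ => h (y i)) x := by
    intro h x
    obtain ⟨i, hi⟩ := hmem x
    rw [Finset.sum_eq_single i, Set.indicator_of_mem (by simpa [C] using hi), hi]
    · intro j _ hj
      refine Set.indicator_of_notMem (fun hx => hj (hy ?_)) _
      exact (Set.mem_singleton_iff.1 hx).symm.trans hi
    · simp
  have hpos : ∀ i, 0 < 1 + (y i : ℝ) := fun i => by positivity
  have hR : ∫ x, Real.log (1 + (f x : ℝ)) ∂F = ∑ i, F.real (C i) * Real.log (1 + (y i : ℝ)) := by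
    simp_rw [hind (fun z => Real.log (1 + (z : ℝ)))]
    rw [integral_finsetSum _ fun i _ => (integrable_const _).indicator (hCm i)]
    refine Finset.sum_congr rfl fun i _ => ?_
    rw [integral_indicator_const _ (hCm i), smul_eq_mul]
  have hθs : ∑ i, θ * F.real (C i) = θ := by rw [← Finset.mul_sum, hsum, mul_one]
  have hD := lintegral_dirichletLaw (a := fun i => θ * F.real (C i)) (x := fun i => (y i : ℝ))
    (fun i => by positivity) (fun i => by positivity) (by rw [hθs]; exact hθ)
  have hmeas : Measurable fun (P : Measure ℝ≥0) i => P.real (C i) :=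
    measurable_pi_lambda _ fun i => (Measure.measurable_coe (hCm i)).ennreal_toReal
  rw [hθs, ← hmap, lintegral_map (by fun_prop) hmeas] at hD
  have hE : ∏ i, (1 + (y i : ℝ)) ^ (-(θ * F.real (C i)))
      = Real.exp (-θ * ∑ i, F.real (C i) * Real.log (1 + (y i : ℝ))) := by
    rw [Finset.mul_sum, Real.exp_sum]
    refine Finset.prod_congr rfl fun i _ => ?_
    rw [Real.rpow_def_of_pos (hpos i)]
    ring_nf
  rw [hR, ← hE, ← hD]
  refine lintegral_congr_ae ?_
  filter_upwards [hQ.ae_isProbabilityMeasure] with P hP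
  have hL : ∫⁻ x, f x ∂P = ENNReal.ofReal (∑ i, y i * P.real (C i)) := by
    have h1 : ∀ x, (f x : ℝ≥0∞) = ∑ i, (C i).indicator (fun _ => (y i : ℝ≥0∞)) x := by
      intro x
      obtain ⟨i, hi⟩ := hmem x
      rw [Finset.sum_eq_single i, Set.indicator_of_mem (by simpa [C] using hi), hi]
      · intro j _ hj
        refine Set.indicator_of_notMem (fun hx => hj (hy ?_)) _
        exact (Set.mem_singleton_iff.1 hx).symm.trans hi
      · simp
    simp_rw [h1]
    rw [lintegral_finsetSum _ fun i _ => measurable_const.indicator (hCm i),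
      ENNReal.ofReal_sum_of_nonneg fun i _ => by positivity]
    refine Finset.sum_congr rfl fun i _ => ?_
    rw [lintegral_indicator_const (hCm i), ENNReal.ofReal_mul (by positivity),
      ENNReal.ofReal_coe_nnreal, ofReal_measureReal]
  have h0 : 0 ≤ ∑ i, (y i : ℝ) * P.real (C i) := Finset.sum_nonneg fun i _ => by positivity
  rw [hL, ← ENNReal.ofReal_one, ← ENNReal.ofReal_add zero_le_one h0,
    ENNReal.ofReal_rpow_of_pos (by positivity)]

theorem one_add_rpow_neg_le_one {θ : ℝ} (hθ : 0 < θ) (x : ℝ≥0∞) : (1 + x) ^ (-θ) ≤ 1 := by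
  rw [ENNReal.rpow_neg, ENNReal.inv_le_one]
  exact ENNReal.one_le_rpow le_self_add hθ

/-- The Cifarelli–Regazzini identity: the generalized Stieltjes transform of order `θ` of a linear
functional of a Dirichlet process. -/
theorem lintegral_dirichletProcess {θ : ℝ} (hθ : 0 < θ) {F : Measure ℝ≥0}
    [IsProbabilityMeasure F] {Q : Measure (Measure ℝ≥0)} (hQ : IsDirichletProcessLaw θ F Q)
    {f : ℝ≥0 → ℝ≥0} (hf : Measurable f) (hint : Integrable (fun x => Real.log (1 + (f x : ℝ))) F) :
    ∫⁻ P, (1 + ∫⁻ x, f x ∂P) ^ (-θ) ∂Q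
      = ENNReal.ofReal (Real.exp (-θ * ∫ x, Real.log (1 + (f x : ℝ)) ∂F)) := by
  have := hQ.isProbabilityMeasure
  have hfe : Measurable fun x => (f x : ℝ≥0∞) := hf.coe_nnreal_ennreal
  -- The values of `eapprox` are finite, so the increasing approximants of `f` may be taken in
  -- `ℝ≥0`.
  let u : ℕ → SimpleFunc ℝ≥0 ℝ≥0 := fun n =>
    (SimpleFunc.eapprox (fun x => (f x : ℝ≥0∞)) n).map ENNReal.toNNReal
  have hu : ∀ n x, (u n x : ℝ≥0∞) = SimpleFunc.eapprox (fun x => (f x : ℝ≥0∞)) n x := fun n x =>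
    ENNReal.coe_toNNReal (SimpleFunc.eapprox_lt_top _ n x).ne
  have hlim : ∀ x, Filter.Tendsto (fun n => (u n x : ℝ≥0∞)) Filter.atTop (nhds (f x)) := fun x => by
    simp_rw [hu]
    exact SimpleFunc.tendsto_eapprox hfe x
  have hmono : ∀ x, Monotone fun n => (u n x : ℝ≥0∞) := fun x n m hnm => by
    simp only [hu]
    exact SimpleFunc.monotone_eapprox _ hnm x
  have hle : ∀ n x, u n x ≤ f x := fun n x =>
    ENNReal.coe_le_coe.1 ((hmono x).ge_of_tendsto (hlim x) n)
  have h1 : Filter.Tendsto (fun n => ∫⁻ P, (1 + ∫⁻ x, u n x ∂P) ^ (-θ) ∂Q) Filter.atTop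
      (nhds (∫⁻ P, (1 + ∫⁻ x, f x ∂P) ^ (-θ) ∂Q)) := by
    refine tendsto_lintegral_of_dominated_convergence (fun _ => 1) (fun n => ?_)
      (fun n => .of_forall fun P => one_add_rpow_neg_le_one hθ _) (by simp) (.of_forall fun P => ?_)
    · exact ((Measure.measurable_lintegral (u n).measurable.coe_nnreal_ennreal).const_add _).pow_const _
    -- Continuity of the power on all of `ℝ≥0∞` covers `P` with infinite integral, where the limit
    -- is `0`.
    · refine (ENNReal.continuous_rpow_const.tendsto _).comp (Filter.Tendsto.const_add _ ?_)
      exact lintegral_tendsto_of_tendsto_of_monotone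
        (fun n => (u n).measurable.coe_nnreal_ennreal.aemeasurable)
        (.of_forall hmono) (.of_forall hlim)
  have h2 : Filter.Tendsto (fun n => ENNReal.ofReal (Real.exp (-θ * ∫ x, Real.log (1 + (u n x : ℝ)) ∂F)))
      Filter.atTop (nhds (ENNReal.ofReal (Real.exp (-θ * ∫ x, Real.log (1 + (f x : ℝ)) ∂F)))) := by
    refine ENNReal.tendsto_ofReal ((Real.continuous_exp.tendsto _).comp (Filter.Tendsto.const_mul _ ?_))
    refine tendsto_integral_of_dominated_convergence _ (fun n => ?_) hint
      (fun n => .of_forall fun x => ?_) (.of_forall fun x => ?_)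
    · have := (u n).measurable
      exact (by fun_prop : Measurable fun x => Real.log (1 + (u n x : ℝ))).aestronglyMeasurable
    · have hx : (u n x : ℝ) ≤ f x := hle n x
      rw [Real.norm_of_nonneg (Real.log_nonneg (by simp))]
      exact Real.log_le_log (by positivity) (by linarith)
    · have h3 : Filter.Tendsto (fun n => (u n x : ℝ)) Filter.atTop (nhds (f x : ℝ)) := by
        exact_mod_cast ENNReal.tendsto_coe.1 (hlim x)
      exact (h3.const_add 1).log (by positivity)
  simp_rw [lintegral_simpleFunc_dirichletProcess hθ hQ] at h1
  exact tendsto_nhds_unique h1 h2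

/-! ### The Dirichlet mean: finiteness and Stieltjes transform. -/

/-- Because `1 + l x ≤ (1 + l)(1 + x)`. -/
theorem integrable_log_one_add_mul {F : Measure ℝ≥0} [IsProbabilityMeasure F]
    (hint : Integrable (fun x : ℝ≥0 => Real.log (1 + (x : ℝ))) F) {l : ℝ} (hl : 0 ≤ l) :
    Integrable (fun x : ℝ≥0 => Real.log (1 + l * (x : ℝ))) F := by
  refine ((integrable_const (Real.log (1 + l))).add hint).mono'
    (by fun_prop : Measurable fun x : ℝ≥0 => Real.log (1 + l * (x : ℝ))).aestronglyMeasurable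
    (.of_forall fun x => ?_)
  have hx : (0 : ℝ) ≤ x := x.2
  have hlx := mul_nonneg hl hx
  rw [Real.norm_of_nonneg (Real.log_nonneg (by linarith)), Pi.add_apply,
    ← Real.log_mul (by positivity) (by positivity)]
  exact Real.log_le_log (by positivity) (by nlinarith)

theorem measurable_meanFunctional : Measurable meanFunctional :=
  Measure.measurable_lintegral (by fun_prop)

theorem lintegral_meanFunctional {θ : ℝ} (hθ : 0 < θ) {F : Measure ℝ≥0}
    [IsProbabilityMeasure F] {Q : Measure (Measure ℝ≥0)} (hQ : IsDirichletProcessLaw θ F Q)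
    (hint : Integrable (fun x : ℝ≥0 => Real.log (1 + (x : ℝ))) F) (l : ℝ≥0) :
    ∫⁻ P, (1 + l * meanFunctional P) ^ (-θ) ∂Q
      = ENNReal.ofReal (Real.exp (-θ * levyExponent F l)) := by
  have h := lintegral_dirichletProcess hθ hQ (f := fun x => l * x) (by fun_prop)
    (by simpa using integrable_log_one_add_mul hint l.2)
  simp only [NNReal.coe_mul, ENNReal.coe_mul] at h
  rw [levyExponent, ← h]
  refine lintegral_congr fun P => ?_
  rw [lintegral_const_mul _ (by fun_prop), meanFunctional]

/-- For `l > 0` the integrand `(1 + l M)^(-θ)` is at most the indicator of `M < ∞`, so this event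
has probability at least `exp(-θ ψ(l))`. Along `l = 1/(n+1)` the bound tends to `1`, by dominated
convergence with majorant `log (1 + x)`. -/
theorem ae_meanFunctional_lt_top {θ : ℝ} (hθ : 0 < θ) {F : Measure ℝ≥0}
    [IsProbabilityMeasure F] {Q : Measure (Measure ℝ≥0)} (hQ : IsDirichletProcessLaw θ F Q)
    (hint : Integrable (fun x : ℝ≥0 => Real.log (1 + (x : ℝ))) F) :
    ∀ᵐ P ∂Q, meanFunctional P < ∞ := by
  have := hQ.isProbabilityMeasure
  have hs : MeasurableSet {P | meanFunctional P < ∞} :=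
    measurableSet_lt measurable_meanFunctional measurable_const
  have hle : ∀ n : ℕ, ENNReal.ofReal (Real.exp (-θ * levyExponent F (1 / ((n : ℝ) + 1))))
      ≤ Q {P | meanFunctional P < ∞} := by
    intro n
    have h := lintegral_meanFunctional hθ hQ hint (1 / ((n : ℝ≥0) + 1))
    have e : (((1 / ((n : ℝ≥0) + 1) : ℝ≥0)) : ℝ) = 1 / ((n : ℝ) + 1) := by push_cast; ring
    rw [← e, ← h, ← lintegral_indicator_one hs]
    refine lintegral_mono fun P => ?_
    by_cases hP : meanFunctional P < ∞
    · rw [Set.indicator_of_mem (by exact hP)]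
      exact one_add_rpow_neg_le_one hθ _
    -- In `ℝ≥0∞`, `l * ∞ = ∞` requires `l ≠ 0`.
    · have h0 : ((1 / ((n : ℝ≥0) + 1) : ℝ≥0) : ℝ≥0∞) ≠ 0 := by
        rw [ENNReal.coe_ne_zero]; positivity
      rw [not_lt_top_iff.1 hP, ENNReal.mul_top h0, add_top, ENNReal.top_rpow_of_neg (by linarith)]
      exact zero_le
  have hl : Filter.Tendsto (fun n : ℕ => levyExponent F (1 / ((n : ℝ) + 1))) Filter.atTop
      (nhds (∫ _, (0 : ℝ) ∂F)) := by
    refine tendsto_integral_of_dominated_convergence _ (fun n => ?_) hint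
      (fun n => .of_forall fun x => ?_) (.of_forall fun x => ?_)
    · exact (by fun_prop : Measurable fun x : ℝ≥0 =>
        Real.log (1 + 1 / ((n : ℝ) + 1) * (x : ℝ))).aestronglyMeasurable
    · have hx : (0 : ℝ) ≤ x := x.2
      have hn : 1 / ((n : ℝ) + 1) ≤ 1 := by
        rw [div_le_one (by positivity)]
        linarith [n.cast_nonneg (α := ℝ)]
      have h0 : 0 ≤ 1 / ((n : ℝ) + 1) * (x : ℝ) := by positivity
      rw [Real.norm_of_nonneg (Real.log_nonneg (by linarith))]
      exact Real.log_le_log (by linarith) (by nlinarith)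
    · have h3 : Filter.Tendsto (fun n : ℕ => 1 + 1 / ((n : ℝ) + 1) * (x : ℝ)) Filter.atTop
          (nhds 1) := by
        simpa using (tendsto_one_div_add_atTop_nhds_zero_nat.mul_const (x : ℝ)).const_add 1
      simpa using h3.log one_ne_zero
  have h1 : Filter.Tendsto (fun n : ℕ => ENNReal.ofReal
      (Real.exp (-θ * levyExponent F (1 / ((n : ℝ) + 1))))) Filter.atTop (nhds 1) := by
    simpa using ENNReal.tendsto_ofReal ((Real.continuous_exp.tendsto _).comp (hl.const_mul (-θ)))
  have h2 := le_of_tendsto' h1 hle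
  exact (mem_ae_iff_prob_eq_one hs).2 (le_antisymm prob_le_one h2)

theorem IsDirichletMeanLaw.isProbabilityMeasure {θ : ℝ} {F : Measure ℝ≥0} {ν : Measure ℝ}
    (h : IsDirichletMeanLaw θ F ν) : IsProbabilityMeasure ν := by
  obtain ⟨Q, hQ, rfl⟩ := h
  have := hQ.isProbabilityMeasure
  exact Measure.isProbabilityMeasure_map measurable_meanFunctional.ennreal_toReal.aemeasurable

theorem IsDirichletMeanLaw.ae_nonneg {θ : ℝ} {F : Measure ℝ≥0} {ν : Measure ℝ}
    (h : IsDirichletMeanLaw θ F ν) : ∀ᵐ m ∂ν, 0 ≤ m := by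
  obtain ⟨Q, hQ, rfl⟩ := h
  rw [ae_map_iff measurable_meanFunctional.ennreal_toReal.aemeasurable measurableSet_Ici]
  exact .of_forall fun P => ENNReal.toReal_nonneg

/-- The generalized Stieltjes transform of the law of a Dirichlet mean. -/
theorem IsDirichletMeanLaw.lintegral_rpow {θ : ℝ} (hθ : 0 < θ) {F : Measure ℝ≥0}
    [IsProbabilityMeasure F] {ν : Measure ℝ} (h : IsDirichletMeanLaw θ F ν)
    (hint : Integrable (fun x : ℝ≥0 => Real.log (1 + (x : ℝ))) F) {l : ℝ} (hl : 0 ≤ l) :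
    ∫⁻ m, ENNReal.ofReal ((1 + l * m) ^ (-θ)) ∂ν
      = ENNReal.ofReal (Real.exp (-θ * levyExponent F l)) := by
  obtain ⟨Q, hQ, rfl⟩ := h
  lift l to ℝ≥0 using hl
  rw [lintegral_map (by fun_prop) measurable_meanFunctional.ennreal_toReal,
    ← lintegral_meanFunctional hθ hQ hint l]
  refine lintegral_congr_ae ?_
  filter_upwards [ae_meanFunctional_lt_top hθ hQ hint] with P hP
  lift meanFunctional P to ℝ≥0 using hP.ne with M
  rw [← ENNReal.coe_mul, ← ENNReal.coe_one, ← ENNReal.coe_add,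
    ← ENNReal.ofReal_coe_nnreal (p := 1 + l * M), ENNReal.ofReal_rpow_of_pos (by positivity)]
  simp

/-! ### Determinacy by moments and by Laplace transforms. -/

/-- The Hausdorff moment problem on `[0, 1]` is determinate. -/
theorem ext_of_moments {μ ν : Measure ℝ} [IsFiniteMeasure μ] [IsFiniteMeasure ν]
    (hμ : ∀ᵐ x ∂μ, x ∈ Set.Icc (0 : ℝ) 1) (hν : ∀ᵐ x ∂ν, x ∈ Set.Icc (0 : ℝ) 1)
    (h : ∀ n : ℕ, ∫⁻ x, ENNReal.ofReal x ^ n ∂μ = ∫⁻ x, ENNReal.ofReal x ^ n ∂ν) : μ = ν := by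
  have hmom : ∀ (ρ : Measure ℝ), (∀ᵐ x ∂ρ, x ∈ Set.Icc (0 : ℝ) 1) → ∀ n : ℕ,
      ∫ x, x ^ n ∂ρ = (∫⁻ x, ENNReal.ofReal x ^ n ∂ρ).toReal := by
    intro ρ hρ n
    rw [integral_eq_lintegral_of_nonneg_ae (hρ.mono fun x hx => pow_nonneg hx.1 n)
      (by fun_prop : Measurable fun x : ℝ => x ^ n).aestronglyMeasurable]
    congr 1
    exact lintegral_congr_ae (hρ.mono fun x hx => ENNReal.ofReal_pow hx.1 n)
  have hcont : ∀ (ρ : Measure ℝ) [IsFiniteMeasure ρ], (∀ᵐ x ∂ρ, x ∈ Set.Icc (0 : ℝ) 1) →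
      ∀ f : ℝ → ℝ, Continuous f → Integrable f ρ := by
    intro ρ _ hρ f hf
    obtain ⟨K, hK⟩ := isCompact_Icc.exists_bound_of_continuousOn
      (hf.continuousOn (s := Set.Icc (0 : ℝ) 1))
    exact (integrable_const K).mono' hf.aestronglyMeasurable (hρ.mono hK)
  have hpoly : ∀ (ρ : Measure ℝ) [IsFiniteMeasure ρ], (∀ᵐ x ∂ρ, x ∈ Set.Icc (0 : ℝ) 1) →
      ∀ p : Polynomial ℝ, ∫ x, p.eval x ∂ρ
        = ∑ i ∈ Finset.range (p.natDegree + 1), p.coeff i * ∫ x, x ^ i ∂ρ := by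
    intro ρ _ hρ p
    simp_rw [Polynomial.eval_eq_sum_range]
    rw [integral_finsetSum _ fun i _ => (hcont ρ hρ _ (by fun_prop))]
    simp_rw [integral_const_mul]
  have happrox : ∀ (ρ : Measure ℝ) [IsFiniteMeasure ρ], (∀ᵐ x ∂ρ, x ∈ Set.Icc (0 : ℝ) 1) →
      ∀ (f : ℝ → ℝ) (p : Polynomial ℝ) (ε : ℝ), Continuous f →
        (∀ x ∈ Set.Icc (0 : ℝ) 1, |p.eval x - f x| < ε) →
        ‖∫ x, p.eval x ∂ρ - ∫ x, f x ∂ρ‖ ≤ ε * ρ.real Set.univ := by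
    intro ρ _ hρ f p ε hf hp
    rw [← integral_sub (hcont ρ hρ _ (by fun_prop)) (hcont ρ hρ _ hf)]
    exact norm_integral_le_of_norm_le_const (hρ.mono fun x hx => (hp x hx).le)
  refine ext_of_forall_integral_eq_of_IsFiniteMeasure fun f => ?_
  have hf := f.continuous
  rw [← sub_eq_zero, ← norm_eq_zero]
  refine le_antisymm (le_of_forall_pos_le_add fun ε hε => ?_) (norm_nonneg _)
  -- The accuracy is chosen so that the errors under `μ` and `ν` add up to at most `ε`; the `+ 1`
  -- keeps the denominator positive.
  have hδ : 0 < ε / (μ.real Set.univ + ν.real Set.univ + 1) := by positivity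
  obtain ⟨p, hp⟩ := exists_polynomial_near_of_continuousOn 0 1 f hf.continuousOn _ hδ
  have h1 := happrox μ hμ f p _ hf hp
  have h2 := happrox ν hν f p _ hf hp
  have h3 : ∫ x, p.eval x ∂μ = ∫ x, p.eval x ∂ν := by
    rw [hpoly μ hμ, hpoly ν hν]
    simp_rw [hmom μ hμ, hmom ν hν, h]
  have h4 : ε / (μ.real Set.univ + ν.real Set.univ + 1) * (μ.real Set.univ + ν.real Set.univ + 1)
      = ε := by field_simp
  have h5 : ∫ x, f x ∂μ - ∫ x, f x ∂ν = (∫ x, p.eval x ∂ν - ∫ x, f x ∂ν)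
      - (∫ x, p.eval x ∂μ - ∫ x, f x ∂μ) := by rw [h3]; ring
  rw [h5, zero_add]
  refine (norm_sub_le _ _).trans ?_
  nlinarith

/-- A finite measure on `[0, ∞)` is determined by its Laplace transform at the natural numbers. -/
theorem ext_of_laplace {μ ν : Measure ℝ} [IsFiniteMeasure μ] [IsFiniteMeasure ν]
    (hμ : ∀ᵐ x ∂μ, 0 ≤ x) (hν : ∀ᵐ x ∂ν, 0 ≤ x)
    (h : ∀ n : ℕ, ∫⁻ x, ENNReal.ofReal (Real.exp (-(n * x))) ∂μ
      = ∫⁻ x, ENNReal.ofReal (Real.exp (-(n * x))) ∂ν) : μ = ν := by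
  have hc : Continuous fun x : ℝ => Real.exp (-x) := by fun_prop
  have hemb : MeasurableEmbedding fun x : ℝ => Real.exp (-x) :=
    hc.measurableEmbedding fun x y hxy => neg_injective (Real.exp_injective hxy)
  have hsupp : ∀ (ρ : Measure ℝ), (∀ᵐ x ∂ρ, 0 ≤ x) →
      ∀ᵐ x ∂ρ.map fun x => Real.exp (-x), x ∈ Set.Icc (0 : ℝ) 1 := fun ρ hρ => by
    rw [hemb.ae_map_iff]
    exact hρ.mono fun x hx => ⟨(Real.exp_pos _).le, Real.exp_le_one_iff.2 (by linarith)⟩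
  -- Under `x ↦ e^{-x}` the Laplace transform at `n` becomes the `n`-th moment of a measure on `[0,
  -- 1]`; the map is an embedding, so the measures can be pulled back.
  have hmap : μ.map (fun x => Real.exp (-x)) = ν.map (fun x => Real.exp (-x)) := by
    refine ext_of_moments (hsupp μ hμ) (hsupp ν hν) fun n => ?_
    have e : ∀ x : ℝ, ENNReal.ofReal (Real.exp (-x)) ^ n = ENNReal.ofReal (Real.exp (-(n * x))) := by
      intro x
      rw [← ENNReal.ofReal_pow (Real.exp_pos _).le, ← Real.exp_nat_mul]
      ring_nf
    rw [hemb.lintegral_map, hemb.lintegral_map]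
    simp_rw [e]
    exact h n
  rw [← hemb.comap_map μ, hmap, hemb.comap_map]

/-! ### Gamma mixtures and recovery of the mixing law. -/

theorem lintegral_exp_neg_gammaMeasure {θ s : ℝ} (hθ : 0 < θ) (hs : 0 ≤ s) :
    ∫⁻ g, ENNReal.ofReal (Real.exp (-(s * g))) ∂gammaMeasure θ 1
      = ENNReal.ofReal ((1 + s) ^ (-θ)) := by
  have h := lintegral_pi_gammaLaw_exp_neg (ι := Unit) (a := fun _ => θ) (x := fun _ => s)
    (fun _ => hθ.le) (fun _ => hs)
  have e : gammaLaw θ = gammaMeasure θ 1 := if_pos hθ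
  simp only [Fintype.sum_unique, Fintype.prod_unique] at h
  rw [← h, ← e, ← (measurePreserving_eval (fun _ : Unit => gammaLaw θ) default).lintegral_comp
    (by fun_prop)]

theorem isProbabilityMeasure_gammaMixture {θ : ℝ} (hθ : 0 < θ) (ν : Measure ℝ)
    [IsProbabilityMeasure ν] : IsProbabilityMeasure (gammaMixture θ ν) := by
  have := isProbabilityMeasure_gammaMeasure hθ one_pos
  exact Measure.isProbabilityMeasure_map (by fun_prop)

theorem ae_nonneg_gammaMixture {θ : ℝ} (hθ : 0 < θ) {ν : Measure ℝ}
    [IsProbabilityMeasure ν] (hν : ∀ᵐ m ∂ν, 0 ≤ m) : ∀ᵐ t ∂gammaMixture θ ν, 0 ≤ t := by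
  have := isProbabilityMeasure_gammaMeasure hθ one_pos
  rw [gammaMixture, ae_map_iff (by fun_prop) measurableSet_Ici]
  have h1 := (Measure.quasiMeasurePreserving_fst (μ := gammaMeasure θ 1) (ν := ν)).ae
    (ae_pos_gammaMeasure θ 1)
  have h2 := (Measure.quasiMeasurePreserving_snd (μ := gammaMeasure θ 1) (ν := ν)).ae hν
  filter_upwards [h1, h2] with z hz1 hz2
  exact mul_nonneg hz1.le hz2

/-- Integrating out the gamma factor first links the Laplace transform of the mixture to the
Stieltjes transform of the mixing law. -/
theorem lintegral_exp_neg_gammaMixture {θ : ℝ} (hθ : 0 < θ) {ν : Measure ℝ}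
    [IsProbabilityMeasure ν] (hν : ∀ᵐ m ∂ν, 0 ≤ m) {l : ℝ} (hl : 0 ≤ l) :
    ∫⁻ t, ENNReal.ofReal (Real.exp (-(l * t))) ∂gammaMixture θ ν
      = ∫⁻ m, ENNReal.ofReal ((1 + l * m) ^ (-θ)) ∂ν := by
  have := isProbabilityMeasure_gammaMeasure hθ one_pos
  rw [gammaMixture, lintegral_map (by fun_prop) (by fun_prop), lintegral_prod_symm _ (by fun_prop)]
  refine lintegral_congr_ae ?_
  filter_upwards [hν] with m hm
  rw [← lintegral_exp_neg_gammaMeasure hθ (mul_nonneg hl hm)]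
  refine lintegral_congr fun g => ?_
  ring_nf

theorem lintegral_pow_gammaMixture {θ : ℝ} (hθ : 0 < θ) {ν : Measure ℝ}
    [IsProbabilityMeasure ν] (n : ℕ) :
    ∫⁻ t, ENNReal.ofReal t ^ n ∂gammaMixture θ ν
      = (∫⁻ g, ENNReal.ofReal g ^ n ∂gammaMeasure θ 1) * ∫⁻ m, ENNReal.ofReal m ^ n ∂ν := by
  have := isProbabilityMeasure_gammaMeasure hθ one_pos
  rw [gammaMixture, lintegral_map (by fun_prop) (by fun_prop),
    ← lintegral_prod_mul (by fun_prop) (by fun_prop)]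
  refine lintegral_congr_ae ?_
  filter_upwards [(Measure.quasiMeasurePreserving_fst (μ := gammaMeasure θ 1) (ν := ν)).ae
    (ae_pos_gammaMeasure θ 1)] with z hz
  rw [ENNReal.ofReal_mul hz.le, mul_pow]

/-- The exact value matters only through being positive and finite, so that it can be cancelled from
moments of a mixture. -/
theorem lintegral_pow_gammaMeasure {θ : ℝ} (hθ : 0 < θ) (n : ℕ) :
    ∫⁻ g, ENNReal.ofReal g ^ n ∂gammaMeasure θ 1
      = ENNReal.ofReal (Real.Gamma (θ + n) / Real.Gamma θ) := by
  have hΓ := Real.Gamma_pos_of_pos hθ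
  have hn : 0 < θ + n := by positivity
  rw [gammaMeasure, lintegral_withDensity_eq_lintegral_mul _ (measurable_gammaPDF θ 1) (by fun_prop),
    ← mul_one (Real.Gamma (θ + n)), ← Real.one_rpow (-(θ + n)), ENNReal.ofReal_div_of_pos hΓ,
    ← lintegral_rpow_mul_exp_neg_mul hn one_pos, div_eq_mul_inv,
    ← lintegral_mul_const' _ _ (by simpa using hΓ), ← lintegral_indicator measurableSet_Ioi]
  refine lintegral_congr_ae ?_
  filter_upwards [compl_mem_ae_iff.2 (measure_singleton (0 : ℝ))] with x hx0
  simp only [Pi.mul_apply]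
  rcases lt_or_gt_of_ne hx0 with hx | hx
  · rw [gammaPDF_of_neg hx, zero_mul, Set.indicator_of_notMem (by simpa using hx.le)]
  · rw [gammaPDF_of_nonneg hx.le, Set.indicator_of_mem (by simpa using hx),
      ← ENNReal.ofReal_pow hx.le, ← ENNReal.ofReal_mul (by positivity),
      ← ENNReal.ofReal_inv_of_pos hΓ, ← ENNReal.ofReal_mul (by positivity),
      show θ + n - 1 = (θ - 1) + n by ring, Real.rpow_add hx, Real.rpow_natCast, Real.one_rpow]
    congr 1
    field_simp
    exact Real.one_rpow θ

/-- The mixing law of a gamma mixture is determined by the mixture, when one of the two candidates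
lives on `[0, 1]`. -/
theorem eq_of_gammaMixture_eq {θ : ℝ} (hθ : 0 < θ) {ν ν' : Measure ℝ} [IsProbabilityMeasure ν]
    [IsProbabilityMeasure ν'] (hν : ∀ᵐ m ∂ν, 0 ≤ m) (hν' : ∀ᵐ m ∂ν', m ∈ Set.Icc (0 : ℝ) 1)
    (h : gammaMixture θ ν = gammaMixture θ ν') : ν = ν' := by
  have hmom : ∀ n : ℕ, ∫⁻ m, ENNReal.ofReal m ^ n ∂ν = ∫⁻ m, ENNReal.ofReal m ^ n ∂ν' := by
    intro n
    have hΓ : 0 < Real.Gamma (θ + n) / Real.Gamma θ :=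
      div_pos (Real.Gamma_pos_of_pos (by positivity)) (Real.Gamma_pos_of_pos hθ)
    have h1 := lintegral_pow_gammaMixture hθ (ν := ν) n
    rw [h, lintegral_pow_gammaMixture hθ, lintegral_pow_gammaMeasure hθ] at h1
    exact ((ENNReal.mul_right_inj (by simpa using hΓ) ENNReal.ofReal_ne_top).1 h1).symm
  have hle : ∀ n : ℕ, ∫⁻ m, ENNReal.ofReal m ^ n ∂ν ≤ 1 := by
    intro n
    rw [hmom]
    refine (lintegral_mono_ae (g := fun _ => 1) (hν'.mono fun m hm => ?_)).trans (by simp)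
    exact pow_le_one₀ zero_le (by simpa using hm.2)
  -- If `ν` charged `{m ≥ t}` for some `t > 1`, its moments would be at least `t ^ n` times that
  -- mass, hence unbounded, against `hle`.
  have hnull : ∀ k : ℕ, ∀ᵐ m ∂ν, m < 1 + 1 / ((k : ℝ) + 1) := by
    intro k
    set t : ℝ := 1 + 1 / ((k : ℝ) + 1) with ht
    have ht1 : 1 < t := by rw [ht]; linarith [show 0 < 1 / ((k : ℝ) + 1) by positivity]
    rw [ae_iff]
    simp only [not_lt]
    by_contra hp
    have hb : ∀ n : ℕ, ENNReal.ofReal t ^ n ≤ (ν {m | t ≤ m})⁻¹ := by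
      intro n
      rw [ENNReal.le_inv_iff_mul_le]
      refine le_trans ?_ (hle n)
      refine le_trans ?_ (mul_meas_ge_le_lintegral (μ := ν) (f := fun m => ENNReal.ofReal m ^ n)
        (by fun_prop) (ENNReal.ofReal t ^ n))
      gcongr
      exact fun hm => pow_le_pow_left₀ zero_le (ENNReal.ofReal_le_ofReal hm) n
    have htop := ENNReal.tendsto_pow_atTop_nhds_top_iff.2 (show 1 < ENNReal.ofReal t by
      simpa using ht1)
    have := le_of_tendsto' htop hb
    exact hp (ENNReal.inv_eq_top.1 (top_le_iff.1 this))
  have hν1 : ∀ᵐ m ∂ν, m ∈ Set.Icc (0 : ℝ) 1 := by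
    filter_upwards [hν, ae_all_iff.2 hnull] with m hm hm'
    refine ⟨hm, ge_of_tendsto' (x := Filter.atTop) (b := m)
      (by simpa using tendsto_one_div_add_atTop_nhds_zero_nat.const_add (1 : ℝ))
      fun k => (hm' k).le⟩
  exact ext_of_moments hν1 hν' hmom

/-! ### The transformation `x ↦ c x / (c x + 1)` of the prior and of the mean. -/

/-- The image of a Dirichlet process under a map of the state space is a Dirichlet process. -/
theorem IsDirichletProcessLaw.map {θ : ℝ} {F : Measure ℝ≥0} {Q : Measure (Measure ℝ≥0)}
    (hQ : IsDirichletProcessLaw θ F Q) {A : ℝ≥0 → ℝ≥0} (hA : Measurable A) :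
    IsDirichletProcessLaw θ (F.map A) (Q.map fun P => P.map A) where
  isProbabilityMeasure := by
    have := hQ.isProbabilityMeasure
    exact Measure.isProbabilityMeasure_map (Measure.measurable_map A hA).aemeasurable
  ae_isProbabilityMeasure := by
    have hs : MeasurableSet {P : Measure ℝ≥0 | IsProbabilityMeasure P} := by
      simp_rw [isProbabilityMeasure_iff]
      exact measurableSet_eq_fun (Measure.measurable_coe .univ) measurable_const
    rw [ae_map_iff (Measure.measurable_map A hA).aemeasurable hs]
    filter_upwards [hQ.ae_isProbabilityMeasure] with P hP
    exact Measure.isProbabilityMeasure_map hA.aemeasurable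
  map_partition k C hC hd hu := by
    have hm : Measurable fun (P : Measure ℝ≥0) i => P.real (C i) :=
      measurable_pi_lambda _ fun i => (Measure.measurable_coe (hC i)).ennreal_toReal
    rw [Measure.map_map hm (Measure.measurable_map A hA)]
    have h := hQ.map_partition k (fun i => A ⁻¹' C i) (fun i => hA (hC i))
      (fun i j hij => (hd hij).preimage A) (by rw [← Set.preimage_iUnion, hu, Set.preimage_univ])
    simp_rw [← map_measureReal_apply hA (hC _)] at h
    exact h

theorem measurable_lawA_map (c : ℝ≥0) : Measurable fun x : ℝ≥0 => c * x / (c * x + 1) := by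
  fun_prop

theorem isProbabilityMeasure_lawA (c : ℝ≥0) (F : Measure ℝ≥0) [IsProbabilityMeasure F] :
    IsProbabilityMeasure (lawA c F) :=
  Measure.isProbabilityMeasure_map (measurable_lawA_map c).aemeasurable

theorem integrable_log_lawA (c : ℝ≥0) (F : Measure ℝ≥0) [IsProbabilityMeasure F] :
    Integrable (fun x : ℝ≥0 => Real.log (1 + (x : ℝ))) (lawA c F) := by
  rw [lawA, integrable_map_measure (by fun_prop : Measurable fun x : ℝ≥0 =>
    Real.log (1 + (x : ℝ))).aestronglyMeasurable (measurable_lawA_map c).aemeasurable]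
  refine (integrable_const (Real.log 2)).mono' (by
    have := measurable_lawA_map c
    exact (by fun_prop : Measurable _).aestronglyMeasurable) (.of_forall fun x => ?_)
  have h1 : ((c * x / (c * x + 1) : ℝ≥0) : ℝ) ≤ 1 := by
    rw [← NNReal.coe_one, NNReal.coe_le_coe]
    exact div_le_one_of_le₀ le_self_add zero_le
  have h0 : (0 : ℝ) ≤ ((c * x / (c * x + 1) : ℝ≥0) : ℝ) := NNReal.coe_nonneg _
  simp only [Function.comp_apply]
  rw [Real.norm_of_nonneg (Real.log_nonneg (by linarith))]
  exact Real.log_le_log (by linarith) (by linarith)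

/-- Take logarithms in `1 + l·cx/(cx+1) = (1 + c(1+l)x)/(1 + cx)`. This is why tilting replaces `X`
by `A_c`. -/
theorem levyExponent_lawA (c : ℝ≥0) (F : Measure ℝ≥0) [IsProbabilityMeasure F]
    (hint : Integrable (fun x : ℝ≥0 => Real.log (1 + (x : ℝ))) F) {l : ℝ} (hl : 0 ≤ l) :
    levyExponent (lawA c F) l = levyExponent F (c * (1 + l)) - levyExponent F c := by
  have hc : (0 : ℝ) ≤ c := c.2
  rw [levyExponent, lawA, integral_map (measurable_lawA_map c).aemeasurable
    (by fun_prop : Measurable fun x : ℝ≥0 => Real.log (1 + l * (x : ℝ))).aestronglyMeasurable,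
    levyExponent, levyExponent, ← integral_sub
      (integrable_log_one_add_mul hint (by positivity)) (integrable_log_one_add_mul hint hc)]
  refine integral_congr_ae (.of_forall fun x => ?_)
  have hx : (0 : ℝ) ≤ x := x.2
  simp only
  rw [← Real.log_div (by positivity) (by positivity)]
  congr 1
  push_cast
  field_simp
  ring

/-- The mean of the Dirichlet process with prior `lawA c F` is obtained from that of the process
with prior `F` by a power tilt followed by `m ↦ c m / (c m + 1)`. -/
theorem IsDirichletMeanLaw.lawA_eq {θ : ℝ} (hθ : 0 < θ) {c : ℝ≥0} {F : Measure ℝ≥0}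
    [IsProbabilityMeasure F] (hint : Integrable (fun x : ℝ≥0 => Real.log (1 + (x : ℝ))) F)
    {ν νc : Measure ℝ} (hν : IsDirichletMeanLaw θ F ν) (hνc : IsDirichletMeanLaw θ (lawA c F) νc) :
    νc = (ν.withDensity fun m => ENNReal.ofReal
      (Real.exp (θ * levyExponent F c) * (1 + c * m) ^ (-θ))).map fun m : ℝ => c * m / (c * m + 1) := by
  have hc : (0 : ℝ) ≤ c := c.2
  have := isProbabilityMeasure_lawA c F
  have := hνc.isProbabilityMeasure
  set w : ℝ → ℝ≥0∞ := fun m => ENNReal.ofReal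
      (Real.exp (θ * levyExponent F c) * (1 + c * m) ^ (-θ)) with hw
  have hwm : Measurable w := by fun_prop
  have hAm : Measurable fun m : ℝ => c * m / (c * m + 1) := by fun_prop
  set ν' := (ν.withDensity w).map fun m : ℝ => c * m / (c * m + 1) with hν'
  -- The transforms match because `(1 + cm)(1 + l·cm/(cm+1)) = 1 + c(1+l)m`; the case `l = 0` makes
  -- `ν'` a probability measure.
  have hst : ∀ l : ℝ, 0 ≤ l → ∫⁻ m, ENNReal.ofReal ((1 + l * m) ^ (-θ)) ∂ν'
      = ∫⁻ m, ENNReal.ofReal ((1 + l * m) ^ (-θ)) ∂νc := by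
    intro l hl
    rw [hνc.lintegral_rpow hθ (integrable_log_lawA c F) hl, levyExponent_lawA c F hint hl, hν',
      lintegral_map (by fun_prop) hAm, lintegral_withDensity_eq_lintegral_mul _ hwm (by fun_prop)]
    have e : Real.exp (-θ * (levyExponent F (c * (1 + l)) - levyExponent F c))
        = Real.exp (θ * levyExponent F c) * Real.exp (-θ * levyExponent F (c * (1 + l))) := by
      rw [← Real.exp_add]; ring_nf
    rw [e, ENNReal.ofReal_mul (Real.exp_pos _).le, ← hν.lintegral_rpow hθ hint (by positivity),
      ← lintegral_const_mul _ (by fun_prop)]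
    refine lintegral_congr_ae ?_
    filter_upwards [hν.ae_nonneg] with m hm
    have hcm : 0 ≤ c * m := mul_nonneg hc hm
    simp only [Pi.mul_apply, hw]
    rw [← ENNReal.ofReal_mul (by positivity), ← ENNReal.ofReal_mul (by positivity), mul_assoc,
      ← Real.mul_rpow (by positivity) (by positivity)]
    congr 3
    field_simp
    ring
  have hprob : IsProbabilityMeasure ν' := ⟨by simpa using hst 0 le_rfl⟩
  have hsupp : ∀ᵐ m ∂ν', m ∈ Set.Icc (0 : ℝ) 1 := by
    refine hν' ▸ (ae_map_iff hAm.aemeasurable (measurableSet_Icc (a := (0 : ℝ)) (b := 1))).2 ?_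
    refine (withDensity_absolutelyContinuous ν w).ae_le ?_
    filter_upwards [hν.ae_nonneg] with m hm
    have hcm : 0 ≤ c * m := mul_nonneg hc hm
    exact ⟨by positivity, div_le_one_of_le₀ (by linarith) (by positivity)⟩
  have := isProbabilityMeasure_gammaMixture hθ ν'
  have := isProbabilityMeasure_gammaMixture hθ νc
  have hnn : ∀ᵐ m ∂ν', 0 ≤ m := hsupp.mono fun m hm => hm.1
  -- Equal Stieltjes transforms of order `θ` are equal Laplace transforms of the gamma mixtures.
  refine eq_of_gammaMixture_eq hθ hνc.ae_nonneg hsupp (ext_of_laplace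
    (ae_nonneg_gammaMixture hθ hνc.ae_nonneg) (ae_nonneg_gammaMixture hθ hnn) fun n => ?_)
  rw [lintegral_exp_neg_gammaMixture hθ hνc.ae_nonneg n.cast_nonneg,
    lintegral_exp_neg_gammaMixture hθ hnn n.cast_nonneg, hst _ n.cast_nonneg]

/-! ### Densities of the transformed means. -/

/-- The density of the image of a weighted law, by change of variables. -/
theorem IsDensity.map_withDensity {ν : Measure ℝ} {ξ w T S S' : ℝ → ℝ} {I J : Set ℝ}
    (hξ : IsDensity ν ξ) (hw : Measurable w) (hT : Measurable T) (hS : Measurable S)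
    (hS' : Measurable S') (hI : MeasurableSet I) (hJ : MeasurableSet J) (hνI : ∀ᵐ x ∂ν, x ∈ I)
    (hw0 : ∀ x ∈ I, 0 ≤ w x) (hderiv : ∀ y ∈ J, HasDerivAt S (S' y) y) (himg : S '' J = I)
    (hTS : ∀ y ∈ J, T (S y) = y) :
    IsDensity ((ν.withDensity fun x => ENNReal.ofReal (w x)).map T)
      (J.indicator fun y => |S' y| * w (S y) * ξ (S y)) := by
  have hinj : Set.InjOn S J := fun x hx y hy hxy => by rw [← hTS x hx, hxy, hTS y hy]
  have hmeas := hξ.measurable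
  have habs : Measurable fun y => |S' y| := hS'.abs
  have hfm : Measurable (J.indicator fun y => |S' y| * w (S y) * ξ (S y)) :=
    ((habs.mul (hw.comp hS)).mul (hmeas.comp hS)).indicator hJ
  refine ⟨hfm, fun y => ?_, ?_⟩
  · refine Set.indicator_nonneg (fun y hy => ?_) y
    have := hw0 (S y) (himg ▸ Set.mem_image_of_mem S hy)
    have := hξ.nonneg (S y)
    positivity
  · refine Measure.ext_of_lintegral _ fun f hf => ?_
    have hfT : Measurable fun x => f (T x) := hf.comp hT
    -- As `ν` lives on `I = S '' J`, the integral is restricted to `I` and the substitution `x = S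
    -- y` made; only the inverse branch `S` has to be differentiable.
    rw [lintegral_map hf hT, lintegral_withDensity_eq_lintegral_mul _ hw.ennreal_ofReal hfT, lintegral_withDensity_eq_lintegral_mul _ hfm.ennreal_ofReal hf,
      ← Measure.restrict_eq_self_of_ae_mem hνI, hξ.eq_withDensity,
      setLIntegral_withDensity_eq_setLIntegral_mul _ hmeas.ennreal_ofReal
        (hw.ennreal_ofReal.mul hfT) hI, ← himg,
      lintegral_image_eq_lintegral_abs_deriv_mul hJ
        (fun y hy => (hderiv y hy).hasDerivWithinAt) hinj, ← lintegral_indicator hJ]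
    refine lintegral_congr fun y => ?_
    by_cases hy : y ∈ J
    · have := hw0 (S y) (himg ▸ Set.mem_image_of_mem S hy)
      have := hξ.nonneg (S y)
      simp only [Set.indicator_of_mem hy, Pi.mul_apply, hTS y hy]
      rw [ENNReal.ofReal_mul (by positivity), ENNReal.ofReal_mul (by positivity)]
      ring
    · simp [Set.indicator_of_notMem hy]

theorem IsDensity.ae_ne {ν : Measure ℝ} {ξ : ℝ → ℝ} (hξ : IsDensity ν ξ) (a : ℝ) :
    ∀ᵐ x ∂ν, x ≠ a := by
  rw [hξ.eq_withDensity]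
  exact (withDensity_absolutelyContinuous _ _).ae_le (Measure.ae_ne _ a)

/-- The inverse of `IsDirichletMeanLaw.lawA_eq` for `c = 1`. -/
theorem IsDirichletMeanLaw.eq_of_lawA_one {θ : ℝ} (hθ : 0 < θ) {F : Measure ℝ≥0}
    [IsProbabilityMeasure F] (hint : Integrable (fun x : ℝ≥0 => Real.log (1 + (x : ℝ))) F)
    {ν ν₁ : Measure ℝ} (hν : IsDirichletMeanLaw θ F ν) (hν₁ : IsDirichletMeanLaw θ (lawA 1 F) ν₁) :
    ν = (ν₁.withDensity fun y => ENNReal.ofReal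
      (Real.exp (-θ * levyExponent F 1) * (1 - y) ^ (-θ))).map fun y : ℝ => y / (1 - y) := by
  have h := hν.lawA_eq hθ hint hν₁
  simp only [NNReal.coe_one, one_mul] at h
  have hAm : Measurable fun m : ℝ => m / (m + 1) := by fun_prop
  have hBm : Measurable fun y : ℝ => y / (1 - y) := by fun_prop
  refine Measure.ext_of_lintegral _ fun f hf => ?_
  have hfB : Measurable fun y : ℝ => f (y / (1 - y)) := hf.comp hBm
  have hv : Measurable fun y => ENNReal.ofReal
      (Real.exp (-θ * levyExponent F 1) * (1 - y) ^ (-θ)) := by fun_prop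
  have hw : Measurable fun m => ENNReal.ofReal
      (Real.exp (θ * levyExponent F 1) * (1 + m) ^ (-θ)) := by fun_prop
  rw [lintegral_map hf hBm, lintegral_withDensity_eq_lintegral_mul _ hv hfB, h,
    lintegral_map (hv.mul hfB) hAm,
    lintegral_withDensity_eq_lintegral_mul _ hw (by exact (hv.mul hfB).comp hAm)]
  refine lintegral_congr_ae ?_
  filter_upwards [hν.ae_nonneg] with m hm
  have h1 : 1 - m / (m + 1) = (1 + m)⁻¹ := by field_simp; ring
  have h2 : m / (m + 1) / (1 + m)⁻¹ = m := by field_simp; ring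
  have h3 : (0 : ℝ) < (1 + m) ^ θ := by positivity
  simp only [Pi.mul_apply]
  rw [h1, h2, ← mul_assoc, ← ENNReal.ofReal_mul (by positivity)]
  -- At `y = m / (m + 1)` one has `1 - y = (1 + m)⁻¹`, so the two weights are reciprocal.
  have e : Real.exp (θ * levyExponent F 1) * (1 + m) ^ (-θ) *
      (Real.exp (-θ * levyExponent F 1) * (1 + m)⁻¹ ^ (-θ)) = 1 := by
    rw [Real.inv_rpow (by positivity), Real.rpow_neg (by positivity), inv_inv, neg_mul,
      Real.exp_neg]
    field_simp
  rw [e, ENNReal.ofReal_one, one_mul]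

/-- At `m = y/(c(1-y))` the weight `(1 + cm)^(-θ)` equals `(1-y)^θ` and the Jacobian is
`1/(c(1-y)^2)`, whence the exponent `θ - 2`. -/
theorem isDensity_lawA {θ : ℝ} (hθ : 0 < θ) {c : ℝ≥0} (hc : 0 < c) {F : Measure ℝ≥0}
    [IsProbabilityMeasure F] (hint : Integrable (fun x : ℝ≥0 => Real.log (1 + (x : ℝ))) F)
    {ν νc : Measure ℝ} {ξ : ℝ → ℝ} (hν : IsDirichletMeanLaw θ F ν)
    (hνc : IsDirichletMeanLaw θ (lawA c F) νc) (hξ : IsDensity ν ξ) :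
    IsDensity νc ((Set.Ioo 0 1).indicator fun y =>
      1 / (c : ℝ) * Real.exp (θ * levyExponent F c) * (1 - y) ^ (θ - 2) *
        ξ (y / (c * (1 - y)))) := by
  have hc' : (0 : ℝ) < c := hc
  rw [hν.lawA_eq hθ hint hνc]
  have hpos : ∀ᵐ m ∂ν, m ∈ Set.Ioi (0 : ℝ) := by
    filter_upwards [hν.ae_nonneg, hξ.ae_ne 0] with m hm hm0
    exact lt_of_le_of_ne hm hm0.symm
  have himg : (fun y : ℝ => y / (c * (1 - y))) '' Set.Ioo 0 1 = Set.Ioi 0 := by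
    ext m
    constructor
    · rintro ⟨y, ⟨hy0, hy1⟩, rfl⟩
      exact Set.mem_Ioi.2 (div_pos hy0 (mul_pos hc' (by linarith)))
    · intro (hm : 0 < m)
      refine ⟨c * m / (c * m + 1), ⟨by positivity, ?_⟩, ?_⟩
      · rw [div_lt_one (by positivity)]
        linarith
      · have : 1 - c * m / (c * m + 1) = (c * m + 1)⁻¹ := by field_simp; ring
        simp only [this]
        field_simp
  have h := hξ.map_withDensity
    (w := fun m => Real.exp (θ * levyExponent F c) * (1 + c * m) ^ (-θ))
    (T := fun m => c * m / (c * m + 1)) (S := fun y => y / (c * (1 - y)))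
    (S' := fun y => 1 / (c * (1 - y) ^ 2)) (I := Set.Ioi 0) (J := Set.Ioo 0 1)
    (by fun_prop) (by fun_prop) (by fun_prop) (by fun_prop) measurableSet_Ioi measurableSet_Ioo
    hpos (fun m (hm : 0 < m) => by positivity) (fun y hy => ?_) himg (fun y hy => ?_)
  · convert h using 1
    refine Set.indicator_congr fun y hy => ?_
    have hy1 : 0 < 1 - y := by linarith [hy.2]
    have e : 1 + c * (y / (c * (1 - y))) = (1 - y)⁻¹ := by field_simp; ring
    rw [e, Real.inv_rpow hy1.le, Real.rpow_neg hy1.le, inv_inv, abs_of_pos (by positivity),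
      Real.rpow_sub hy1, Real.rpow_two]
    field_simp
  · have hy1 : 1 - y ≠ 0 := by linarith [hy.2]
    refine ((hasDerivAt_id' y).fun_div (((hasDerivAt_id' y).const_sub 1).const_mul (c : ℝ))
      (mul_ne_zero hc'.ne' hy1)).congr_deriv ?_
    field_simp
    ring
  · have hy1 : 1 - y ≠ 0 := by linarith [hy.2]
    have e : c * (y / (c * (1 - y))) = y / (1 - y) := by field_simp
    have e' : y / (1 - y) + 1 = (1 - y)⁻¹ := by field_simp; ring
    simp only [e, e']
    field_simp

theorem isDensity_of_lawA_one {θ : ℝ} (hθ : 0 < θ) {F : Measure ℝ≥0}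
    [IsProbabilityMeasure F] (hint : Integrable (fun x : ℝ≥0 => Real.log (1 + (x : ℝ))) F)
    {ν ν₁ : Measure ℝ} {ξ₁ : ℝ → ℝ} (hν : IsDirichletMeanLaw θ F ν)
    (hν₁ : IsDirichletMeanLaw θ (lawA 1 F) ν₁) (hξ : IsDensity ν₁ ξ₁) :
    IsDensity ν ((Set.Ioi 0).indicator fun x =>
      (1 + x) ^ (θ - 2) * ξ₁ (x / (1 + x)) * Real.exp (-θ * levyExponent F 1)) := by
  -- No mass sits at `1`: `ν₁` is carried by the values `m/(m+1)` with `m` finite and nonnegative.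
  have hlt : ∀ᵐ y ∂ν₁, y < 1 := by
    rw [hν.lawA_eq hθ hint hν₁, ae_map_iff (by fun_prop) measurableSet_Iio]
    refine (withDensity_absolutelyContinuous ν _).ae_le ?_
    filter_upwards [hν.ae_nonneg] with m hm
    simp only [NNReal.coe_one, one_mul]
    rw [div_lt_one (by positivity)]
    linarith
  have hpos : ∀ᵐ y ∂ν₁, y ∈ Set.Ioo (0 : ℝ) 1 := by
    filter_upwards [hlt, hν₁.ae_nonneg, hξ.ae_ne 0] with y hy1 hy hy0
    exact ⟨lt_of_le_of_ne hy hy0.symm, hy1⟩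
  rw [hν.eq_of_lawA_one hθ hint hν₁]
  have himg : (fun x : ℝ => x / (1 + x)) '' Set.Ioi 0 = Set.Ioo 0 1 := by
    ext y
    constructor
    · rintro ⟨x, hx, rfl⟩
      have hx : 0 < x := hx
      exact ⟨by positivity, (div_lt_one (by positivity)).2 (by linarith)⟩
    · rintro ⟨hy0, hy1⟩
      have hy1' : 0 < 1 - y := by linarith
      refine ⟨y / (1 - y), Set.mem_Ioi.2 (by positivity), ?_⟩
      have : 1 + y / (1 - y) = (1 - y)⁻¹ := by field_simp; ring
      simp only [this]
      field_simp
  have h := hξ.map_withDensity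
    (w := fun y => Real.exp (-θ * levyExponent F 1) * (1 - y) ^ (-θ))
    (T := fun y => y / (1 - y)) (S := fun x => x / (1 + x))
    (S' := fun x => 1 / (1 + x) ^ 2) (I := Set.Ioo 0 1) (J := Set.Ioi 0)
    (by fun_prop) (by fun_prop) (by fun_prop) (by fun_prop) measurableSet_Ioo measurableSet_Ioi
    hpos (fun y hy => mul_nonneg (Real.exp_pos _).le (Real.rpow_nonneg (by linarith [hy.2]) _))
    (fun x hx => ?_) himg (fun x hx => ?_)
  · convert h using 1
    refine Set.indicator_congr fun x hx => ?_
    have hx0 : 0 < x := hx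
    have hx1 : 0 < 1 + x := by linarith
    have e : 1 - x / (1 + x) = (1 + x)⁻¹ := by field_simp; ring
    rw [e, Real.inv_rpow hx1.le, Real.rpow_neg hx1.le, inv_inv, abs_of_pos (by positivity),
      Real.rpow_sub hx1, Real.rpow_two]
    field_simp
  · have hx0 : 0 < x := hx
    have hx1 : 1 + x ≠ 0 := by linarith
    refine ((hasDerivAt_id' x).fun_div ((hasDerivAt_id' x).const_add 1) hx1).congr_deriv ?_
    ring
  · have hx0 : 0 < x := hx
    have e : 1 - x / (1 + x) = (1 + x)⁻¹ := by field_simp; ring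
    simp only [e]
    field_simp

/-! ### Exponential tilting of generalized gamma convolutions. -/

theorem IsGGC.lintegral_exp_neg {θ : ℝ} (hθ : 0 < θ) {F : Measure ℝ≥0} [IsProbabilityMeasure F]
    (hint : Integrable (fun x : ℝ≥0 => Real.log (1 + (x : ℝ))) F) {τ : Measure ℝ}
    (hτ : IsGGC θ F τ) {l : ℝ} (hl : 0 ≤ l) :
    ∫⁻ t, ENNReal.ofReal (Real.exp (-(l * t))) ∂τ
      = ENNReal.ofReal (Real.exp (-θ * levyExponent F l)) := by
  obtain ⟨ν, hν, rfl⟩ := hτ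
  have := hν.isProbabilityMeasure
  rw [lintegral_exp_neg_gammaMixture hθ hν.ae_nonneg hl, hν.lintegral_rpow hθ hint hl]

theorem IsGGC.isProbabilityMeasure {θ : ℝ} (hθ : 0 < θ) {F : Measure ℝ≥0} {τ : Measure ℝ}
    (hτ : IsGGC θ F τ) : IsProbabilityMeasure τ := by
  obtain ⟨ν, hν, rfl⟩ := hτ
  have := hν.isProbabilityMeasure
  exact isProbabilityMeasure_gammaMixture hθ ν

theorem IsGGC.ae_nonneg {θ : ℝ} (hθ : 0 < θ) {F : Measure ℝ≥0} {τ : Measure ℝ}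
    (hτ : IsGGC θ F τ) : ∀ᵐ t ∂τ, 0 ≤ t := by
  obtain ⟨ν, hν, rfl⟩ := hτ
  have := hν.isProbabilityMeasure
  exact ae_nonneg_gammaMixture hθ hν.ae_nonneg

/-- The process behind `τ` is pushed forward, so no Dirichlet process has to be constructed. -/
theorem IsGGC.exists_lawA {θ : ℝ} {F : Measure ℝ≥0} {τ : Measure ℝ} (hτ : IsGGC θ F τ)
    (c : ℝ≥0) : ∃ τ', IsGGC θ (lawA c F) τ' := by
  obtain ⟨ν, ⟨Q, hQ, -⟩, -⟩ := hτ
  exact ⟨_, _, ⟨_, hQ.map (measurable_lawA_map c), rfl⟩, rfl⟩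

/-- The normalizing integral is the Laplace transform of the GGC law at `c`. -/
theorem tiltedDensity_eq {θ : ℝ} (hθ : 0 < θ) (c : ℝ≥0) {F : Measure ℝ≥0}
    [IsProbabilityMeasure F] (hint : Integrable (fun x : ℝ≥0 => Real.log (1 + (x : ℝ))) F)
    {τ : Measure ℝ} {g : ℝ → ℝ} (hτ : IsGGC θ F τ) (hg : IsDensity τ g) (t : ℝ) :
    tiltedDensity c g t =
      Real.exp (-t) * (1 / (c : ℝ)) * g (t / c) * Real.exp (θ * levyExponent F c) := by
  have hgm := hg.measurable
  have hI : ∫ s, Real.exp (-c * s) * g s = Real.exp (-θ * levyExponent F c) := by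
    have h := hτ.lintegral_exp_neg hθ hint c.2
    rw [hg.eq_withDensity, lintegral_withDensity_eq_lintegral_mul _ hgm.ennreal_ofReal
      (by fun_prop)] at h
    rw [integral_eq_lintegral_of_nonneg_ae
      (.of_forall fun s => mul_nonneg (Real.exp_pos _).le (hg.nonneg s))
      (by fun_prop : Measurable fun s => Real.exp (-c * s) * g s).aestronglyMeasurable,
      ← ENNReal.toReal_ofReal (Real.exp_pos (-θ * levyExponent F c)).le]
    congr 1
    refine Eq.trans (lintegral_congr fun s => ?_) h
    simp only [Pi.mul_apply]
    rw [← ENNReal.ofReal_mul (hg.nonneg s), mul_comm, neg_mul]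
    rfl
  rw [tiltedDensity, hI, neg_mul, Real.exp_neg (θ * _), div_inv_eq_mul]
  ring

/-- The exponential tilt of a `GGC(θ, F)` law, rescaled by `c`. -/
theorem exists_tilted_isGGC {θ : ℝ} (hθ : 0 < θ) {c : ℝ≥0} (hc : 0 < c) {F : Measure ℝ≥0}
    [IsProbabilityMeasure F] (hint : Integrable (fun x : ℝ≥0 => Real.log (1 + (x : ℝ))) F)
    {τ : Measure ℝ} {g : ℝ → ℝ} (hτ : IsGGC θ F τ) (hg : IsDensity τ g) :
    ∃ τc : Measure ℝ, IsDensity τc (tiltedDensity c g) ∧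
      (∀ l : ℝ, 0 ≤ l → ∫ t, Real.exp (-l * t) ∂τc =
        Real.exp (-θ * (levyExponent F (c * (1 + l)) - levyExponent F c))) ∧
      IsGGC θ (lawA c F) τc := by
  have hc' : (0 : ℝ) < c := hc
  have := isProbabilityMeasure_lawA c F
  have := hτ.isProbabilityMeasure hθ
  set w : ℝ → ℝ := fun s => Real.exp (θ * levyExponent F c) * Real.exp (-(c * s)) with hw
  have hwm : Measurable fun s => ENNReal.ofReal (w s) := by fun_prop
  set τc := (τ.withDensity fun s => ENNReal.ofReal (w s)).map fun s : ℝ => c * s with hτc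
  have hlap : ∀ l : ℝ, 0 ≤ l → ∫⁻ t, ENNReal.ofReal (Real.exp (-(l * t))) ∂τc =
      ENNReal.ofReal (Real.exp (-θ * (levyExponent F (c * (1 + l)) - levyExponent F c))) := by
    intro l hl
    have e : Real.exp (-θ * (levyExponent F (c * (1 + l)) - levyExponent F c))
        = Real.exp (θ * levyExponent F c) * Real.exp (-θ * levyExponent F (c * (1 + l))) := by
      rw [← Real.exp_add]; ring_nf
    rw [hτc, lintegral_map (by fun_prop) (by fun_prop),
      lintegral_withDensity_eq_lintegral_mul _ hwm (by fun_prop), e,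
      ENNReal.ofReal_mul (Real.exp_pos _).le, ← hτ.lintegral_exp_neg hθ hint (by positivity),
      ← lintegral_const_mul _ (by fun_prop)]
    refine lintegral_congr fun s => ?_
    simp only [Pi.mul_apply, hw]
    rw [← ENNReal.ofReal_mul (by positivity), ← ENNReal.ofReal_mul (by positivity), mul_assoc,
      ← Real.exp_add]
    ring_nf
  obtain ⟨τ', hτ'⟩ := hτ.exists_lawA c
  have := hτ'.isProbabilityMeasure hθ
  have hprob : IsProbabilityMeasure τc := ⟨by simpa using hlap 0 le_rfl⟩
  have hnn : ∀ᵐ t ∂τc, 0 ≤ t := by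
    rw [hτc, ae_map_iff (by fun_prop) measurableSet_Ici]
    refine (withDensity_absolutelyContinuous τ _).ae_le ?_
    filter_upwards [hτ.ae_nonneg hθ] with s hs
    exact mul_nonneg hc'.le hs
  -- The tilted law is identified with an actual `GGC(θ, F_{A_c})` law by comparing Laplace
  -- transforms.
  have heq : τc = τ' := ext_of_laplace hnn (hτ'.ae_nonneg hθ) fun n => by
    rw [hlap n n.cast_nonneg, hτ'.lintegral_exp_neg hθ (integrable_log_lawA c F) n.cast_nonneg,
      levyExponent_lawA c F hint n.cast_nonneg]
  refine ⟨τc, ?_, fun l hl => ?_, heq ▸ hτ'⟩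
  · have h := hg.map_withDensity (w := w) (T := fun s => c * s) (S := fun t => t / c)
      (S' := fun _ => 1 / (c : ℝ)) (I := Set.univ) (J := Set.univ)
      (by fun_prop) (by fun_prop) (by fun_prop) (by fun_prop) .univ .univ (by simp)
      (fun s _ => by positivity) (fun t _ => (hasDerivAt_id t).div_const (c : ℝ))
      (Set.image_univ_of_surjective fun s => ⟨c * s, by field_simp⟩) (fun t _ => by field_simp)
    convert h using 1
    ext t
    rw [tiltedDensity_eq hθ c hint hτ hg, Set.indicator_univ, abs_of_pos (by positivity)]
    simp only [hw]
    rw [mul_div_cancel₀ t hc'.ne']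
    ring
  · rw [integral_eq_lintegral_of_nonneg_ae (.of_forall fun t => (Real.exp_pos _).le)
      (by fun_prop : Measurable fun t => Real.exp (-l * t)).aestronglyMeasurable]
    simp_rw [neg_mul l]
    rw [hlap l hl, ENNReal.toReal_ofReal (Real.exp_pos _).le]

theorem theorem3p1 {Ω : Type*} [MeasurableSpace Ω] (μ : Measure Ω) [IsProbabilityMeasure μ]
    (X : Ω → ℝ≥0) (hX : Measurable X)
    (hlog : Integrable (fun ω => Real.log (1 + (X ω : ℝ))) μ)
    (θ : ℝ) (hθ : 0 < θ) (c : ℝ≥0) (hc : 0 < c) :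
    -- the Dirichlet mean `M_θ(F_X)` is almost surely finite
    (∀ Q, IsDirichletProcessLaw θ (μ.map X) Q → ∀ᵐ P ∂Q, meanFunctional P < ∞) ∧
    -- exponential tilting of a `GGC(θ, F_X)` density
    (∀ (τ : Measure ℝ) (g : ℝ → ℝ), IsGGC θ (μ.map X) τ → IsDensity τ g →
      (∀ t, tiltedDensity c g t =
        Real.exp (-t) * (1 / (c : ℝ)) * g (t / c) * Real.exp (θ * levyExponent (μ.map X) c)) ∧
      ∃ τc : Measure ℝ, IsDensity τc (tiltedDensity c g) ∧
        (∀ l : ℝ, 0 ≤ l → ∫ t, Real.exp (-l * t) ∂τc =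
          Real.exp (-θ * (levyExponent (μ.map X) (c * (1 + l)) - levyExponent (μ.map X) c))) ∧
        IsGGC θ (lawA c (μ.map X)) τc) ∧
    -- (i) the density of `M_θ(F_{A_c})` from that of `M_θ(F_X)`
    (∀ (ν νc : Measure ℝ) (ξ : ℝ → ℝ), IsDirichletMeanLaw θ (μ.map X) ν →
      IsDirichletMeanLaw θ (lawA c (μ.map X)) νc → IsDensity ν ξ →
      IsDensity νc ((Set.Ioo 0 1).indicator fun y =>
        1 / (c : ℝ) * Real.exp (θ * levyExponent (μ.map X) c) * (1 - y) ^ (θ - 2) *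
          ξ (y / (c * (1 - y))))) ∧
    -- (ii) the density of `M_θ(F_X)` from that of `M_θ(F_{A_1})`
    (∀ (ν ν₁ : Measure ℝ) (ξ₁ : ℝ → ℝ), IsDirichletMeanLaw θ (μ.map X) ν →
      IsDirichletMeanLaw θ (lawA 1 (μ.map X)) ν₁ → IsDensity ν₁ ξ₁ →
      IsDensity ν ((Set.Ioi 0).indicator fun x =>
        (1 + x) ^ (θ - 2) * ξ₁ (x / (1 + x)) *
          Real.exp (-θ * levyExponent (μ.map X) 1))) := by
  have : IsProbabilityMeasure (μ.map X) := Measure.isProbabilityMeasure_map hX.aemeasurable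
  have hint : Integrable (fun x : ℝ≥0 => Real.log (1 + (x : ℝ))) (μ.map X) :=
    (integrable_map_measure (by fun_prop : Measurable fun x : ℝ≥0 =>
      Real.log (1 + (x : ℝ))).aestronglyMeasurable hX.aemeasurable).2 hlog
  exact ⟨fun Q hQ => ae_meanFunctional_lt_top hθ hQ hint,
    fun τ g hτ hg => ⟨tiltedDensity_eq hθ c hint hτ hg, exists_tilted_isGGC hθ hc hint hτ hg⟩,
    fun ν νc ξ hν hνc hξ => isDensity_lawA hθ hc hint hν hνc hξ,
    fun ν ν₁ ξ₁ hν hν₁ hξ => isDensity_of_lawA_one hθ hint hν hν₁ hξ⟩
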